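/- Let $\kappa_0>0$ and $\kappa<0$. Consider the Einstein--Maxwell equations coupled to a massless ghost scalar field $\Phi$ in spherical symmetry, for a metric $ds^2=-e^{2d}dt^2+e^{2a}dx^2+e^{2c}(d\vartheta^2+\sin^2\vartheta\,d\varphi^2)$ with $d,a,c,\Phi$ functions of $(t,x)$. Maxwell's equations are solved by constant electric and magnetic charges $Q_e,Q_m$; with $Q^2=Q_e^2+Q_m^2$ the remaining equations are $$\partial_t(e^{a-d}a_t)-\partial_x(e^{d-a}d_x)-e^{a-d}c_t^2+e^{d-a}c_x^2-e^{a+d-2c}=-\kappa_0Q^2e^{a+d-4c}-\tfrac{\kappa}{2}\left[e^{a-d}\Phi_t^2-e^{d-a}\Phi_x^2\right],$$ $$\partial_t(e^{a-d+2c}c_t)-\partial_x(e^{d-a+2c}c_x)=-e^{a+d}+\tfrac{\kappa_0}{2}Q^2e^{a+d-2c},\qquad \partial_t(e^{a-d+2c}\Phi_t)-\partial_x(e^{d-a+2c}\Phi_x)=0,$$ $$e^{d-a}\left[2c_{xx}+(3c_x-2a_x)c_x\right]-e^{a-d}c_t(2a_t+c_t)-e^{a+d-2c}+\tfrac{\kappa_0}{2}Q^2e^{a+d-4c}+\tfrac{\kappa}{2}\left[e^{a-d}\Phi_t^2+e^{d-a}\Phi_x^2\right]=0,$$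 $$2c_{tx}+2c_tc_x-2d_xc_t-2a_tc_x+\kappa\Phi_t\Phi_x=0.$$ A static charged wormhole has parameters $b>0$, $\gamma_0,\gamma_1,Q_e,Q_m,\Phi_1\in\mathbb R$. Put $y=\arctan(x/b)$ and $\Lambda^2=\gamma_1^2-\kappa_0Q^2e^{2\gamma_0}/(2b^2)$. The wormhole is $$d=\gamma_0-\log\left[\cosh(\Lambda y)-\gamma_1\tfrac{\sinh(\Lambda y)}{\Lambda}\right],\quad a=-d,\quad e^{2(c+d)}=x^2+b^2,\quad \Phi=\Phi_1y,$$ where the bracket is required to be positive for $y\in[-\pi/2,\pi/2]$ and $-\kappa\Phi_1^2=2(1+\Lambda^2)$. It is critical if $\Lambda=0$; then the bracket is $1-\gamma_1y$ and its positivity means $\frac{\pi}{2}|\gamma_1|<1$. Put $\partial=e^{2d}\partial_x$ and $\partial_y=\frac{x^2+b^2}{b}\partial_x$, with $c_y=\partial_yc$ and $d_y=\partial_yd$, and $$F=1+\frac{(\Lambda^2x/b+d_y)\,y}{1+\Lambda^2},\qquad G=e^{-c}\frac{\Lambda^2}{1+\Lambda^2}\left(1+\tfrac{x}{b}y\right),\qquad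 H=e^{-c}F,$$ $$W=b^2e^{-4c}\left\{-3(1+\Lambda^2)+2d_y(d_y-c_y)-4\frac GH\left[c_yd_y+1+\Lambda^2\right]+2c_y^2\left(\frac GH\right)^2\right\}.$$ For a perturbation $(\delta d,\delta a,\delta c,\delta\Phi)$ put $$A=\delta a-e^{-a}\left(e^a\frac{\delta\Phi}{\Phi_x}\right)_x,\quad C=\delta c-c_x\frac{\delta\Phi}{\Phi_x},\quad u_1=e^{-c}(A-C),\quad u_2=e^{-c}C,\quad \chi=u_1-\frac GH u_2.$$ A bound state of energy $E$ of $-\partial^2+W$ is a nonzero real $C^2$ function $\psi\in L^2(\mathbb R,e^{-2d}dx)$ with $-\partial^2\psi+W\psi=E\psi$. **Theorem.** Every critical wormhole is linearly unstable. More precisely, for every critical wormhole: 1. The zero mode $\chi_0=c_y/(e^cF)$ is a $C^2$ solution of $-\partial^2\chi_0+W\chi_0=0$ that does not belong to $L^2(\mathbb R,e^{-2d}dx)$. 2. The operator $-\partial^2+W$ has exactly one bound state of negative energy up to multiples: there are $\beta>0$ and a bound state $\chi_\beta$ of energy $-\beta^2$ such that every bound state of energy $E<0$ has $E=-\beta^2$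 and is a multiple of $\chi_\beta$. 3. With the same $\beta$ and $\chi_\beta$, there is a perturbation $(\delta d,\delta a,\delta c,\delta\Phi)$, each component being $e^{\beta t}$ times a smooth function of $x$, that solves the linearization at the wormhole (with fixed charges) of all the field equations above, with $u_1(t,\cdot),u_2(t,\cdot)\in L^2(\mathbb R,e^{-2d}dx)$ for every $t$, with $(u_1,u_2)\not\equiv0$, and with $\chi(t,x)=e^{\beta t}\chi_\beta(x)$. -/

import Mathlib

noncomputable section

/-! ## The spherically symmetric Einstein–Maxwell–ghost scalar equations

The metric is `-e^{2d} dt² + e^{2a} dx² + e^{2c} (dϑ² + sin² ϑ dφ²)`, the scalar field is `Φ`,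
all depending on `(t, x)`.  Maxwell's equations have been solved in terms of the constant electric
and magnetic charges, which enter only through `Qsq = Q_e² + Q_m²`. -/

namespace ChargedWormhole

/-- The dynamical fields `d, a, c, Φ`, as functions of `t` and then `x`. -/
structure Fields where
  d : ℝ → ℝ → ℝ
  a : ℝ → ℝ → ℝ
  c : ℝ → ℝ → ℝ
  Φ : ℝ → ℝ → ℝ

/-- The one-parameter family `S + s δ` of fields. -/
def Fields.perturb (S δ : Fields) (s : ℝ) : Fields where
  d := fun t x => S.d t x + s * δ.d t x
  a := fun t x => S.a t x + s * δ.a t x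
  c := fun t x => S.c t x + s * δ.c t x
  Φ := fun t x => S.Φ t x + s * δ.Φ t x

/-- Partial derivative with respect to `t`. -/
def pt (f : ℝ → ℝ → ℝ) (t x : ℝ) : ℝ := deriv (fun s => f s x) t

/-- Partial derivative with respect to `x`. -/
def px (f : ℝ → ℝ → ℝ) (t x : ℝ) : ℝ := deriv (fun z => f t z) x

/-- First evolution equation (left-hand side minus right-hand side). -/
def evolution₁ (κ₀ κ Qsq : ℝ) (S : Fields) (t x : ℝ) : ℝ :=
  pt (fun t x => Real.exp (S.a t x - S.d t x) * pt S.a t x) t x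
    - px (fun t x => Real.exp (S.d t x - S.a t x) * px S.d t x) t x
    - Real.exp (S.a t x - S.d t x) * (pt S.c t x) ^ 2
    + Real.exp (S.d t x - S.a t x) * (px S.c t x) ^ 2
    - Real.exp (S.a t x + S.d t x - 2 * S.c t x)
    - (-κ₀ * Qsq * Real.exp (S.a t x + S.d t x - 4 * S.c t x)
        - κ / 2 * (Real.exp (S.a t x - S.d t x) * (pt S.Φ t x) ^ 2
            - Real.exp (S.d t x - S.a t x) * (px S.Φ t x) ^ 2))

/-- Second evolution equation (left-hand side minus right-hand side). -/
def evolution₂ (κ₀ Qsq : ℝ) (S : Fields) (t x : ℝ) : ℝ :=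
  pt (fun t x => Real.exp (S.a t x - S.d t x + 2 * S.c t x) * pt S.c t x) t x
    - px (fun t x => Real.exp (S.d t x - S.a t x + 2 * S.c t x) * px S.c t x) t x
    - (-Real.exp (S.a t x + S.d t x)
        + κ₀ / 2 * Qsq * Real.exp (S.a t x + S.d t x - 2 * S.c t x))

/-- Third evolution equation: the wave equation for the scalar field. -/
def evolution₃ (S : Fields) (t x : ℝ) : ℝ :=
  pt (fun t x => Real.exp (S.a t x - S.d t x + 2 * S.c t x) * pt S.Φ t x) t x
    - px (fun t x => Real.exp (S.d t x - S.a t x + 2 * S.c t x) * px S.Φ t x) t x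

/-- The Hamiltonian constraint. -/
def hamiltonian (κ₀ κ Qsq : ℝ) (S : Fields) (t x : ℝ) : ℝ :=
  Real.exp (S.d t x - S.a t x)
      * (2 * px (px S.c) t x + (3 * px S.c t x - 2 * px S.a t x) * px S.c t x)
    - Real.exp (S.a t x - S.d t x) * pt S.c t x * (2 * pt S.a t x + pt S.c t x)
    - Real.exp (S.a t x + S.d t x - 2 * S.c t x)
    + κ₀ / 2 * Qsq * Real.exp (S.a t x + S.d t x - 4 * S.c t x)
    + κ / 2 * (Real.exp (S.a t x - S.d t x) * (pt S.Φ t x) ^ 2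
        + Real.exp (S.d t x - S.a t x) * (px S.Φ t x) ^ 2)

/-- The momentum constraint. -/
def momentum (κ : ℝ) (S : Fields) (t x : ℝ) : ℝ :=
  2 * pt (px S.c) t x + 2 * pt S.c t x * px S.c t x - 2 * px S.d t x * pt S.c t x
    - 2 * pt S.a t x * px S.c t x + κ * pt S.Φ t x * px S.Φ t x

/-- `δ` solves the linearization at `S` of all field equations, with the charges held fixed: the
derivative at `s = 0` of each equation along `S + s δ` exists and vanishes at every `(t, x)`. -/
def SolvesLinearizedEquations (κ₀ κ Qsq : ℝ) (S δ : Fields) : Prop :=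
  ∀ t x : ℝ,
    HasDerivAt (fun s => evolution₁ κ₀ κ Qsq (S.perturb δ s) t x) 0 0 ∧
    HasDerivAt (fun s => evolution₂ κ₀ Qsq (S.perturb δ s) t x) 0 0 ∧
    HasDerivAt (fun s => evolution₃ (S.perturb δ s) t x) 0 0 ∧
    HasDerivAt (fun s => hamiltonian κ₀ κ Qsq (S.perturb δ s) t x) 0 0 ∧
    HasDerivAt (fun s => momentum κ (S.perturb δ s) t x) 0 0

/-! ## The static wormholes -/

/-- The function `cosh (Λ y) - γ₁ sinh (Λ y) / Λ` in terms of `Lsq = Λ²`, where `Λ` is positive,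
zero or positive imaginary. -/
def profile (Lsq γ₁ y : ℝ) : ℝ :=
  if 0 < Lsq then
    Real.cosh (√Lsq * y) - γ₁ * (Real.sinh (√Lsq * y) / √Lsq)
  else if Lsq = 0 then
    1 - γ₁ * y
  else
    Real.cos (√(-Lsq) * y) - γ₁ * (Real.sin (√(-Lsq) * y) / √(-Lsq))

/-- `Λ² = γ₁² - κ₀ (Q_e² + Q_m²) e^{2γ₀} / (2 b²)`. -/
def lambdaSq (κ₀ b γ₀ γ₁ Qe Qm : ℝ) : ℝ :=
  γ₁ ^ 2 - κ₀ * (Qe ^ 2 + Qm ^ 2) * Real.exp (2 * γ₀) / (2 * b ^ 2)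

/-- The parameters of a static, spherically symmetric charged wormhole in the theory with coupling
constants `κ₀` and `κ`. -/
structure Wormhole (κ₀ κ : ℝ) where
  b : ℝ
  γ₀ : ℝ
  γ₁ : ℝ
  Qe : ℝ
  Qm : ℝ
  Φ₁ : ℝ
  b_pos : 0 < b
  profile_pos : ∀ y ∈ Set.Icc (-(Real.pi / 2)) (Real.pi / 2),
    0 < profile (lambdaSq κ₀ b γ₀ γ₁ Qe Qm) γ₁ y
  scalar_amplitude : -κ * Φ₁ ^ 2 = 2 * (1 + lambdaSq κ₀ b γ₀ γ₁ Qe Qm)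

namespace Wormhole

variable {κ₀ κ : ℝ} (w : Wormhole κ₀ κ)

/-- `Λ²` of the wormhole. -/
def Lsq : ℝ := lambdaSq κ₀ w.b w.γ₀ w.γ₁ w.Qe w.Qm

/-- The wormhole is critical if `Λ = 0`. -/
def IsCritical : Prop := w.Lsq = 0

/-- `Q² = Q_e² + Q_m²`. -/
def Qsq : ℝ := w.Qe ^ 2 + w.Qm ^ 2

/-- `y = arctan (x / b)`. -/
def y (x : ℝ) : ℝ := Real.arctan (x / w.b)

/-- The metric function `d`. -/
def d (x : ℝ) : ℝ := w.γ₀ - Real.log (profile w.Lsq w.γ₁ (w.y x))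

/-- The metric function `c`, given by `e^{2(c+d)} = x² + b²`. -/
def c (x : ℝ) : ℝ := Real.log (√(x ^ 2 + w.b ^ 2)) - w.d x

/-- The static wormhole as a solution of the field equations, in the gauge `a = -d`. -/
def background : Fields where
  d := fun _ x => w.d x
  a := fun _ x => -w.d x
  c := fun _ x => w.c x
  Φ := fun _ x => w.Φ₁ * w.y x

/-- Derivative with respect to `y = arctan (x / b)` of a function of `x`. -/
def dy (f : ℝ → ℝ) (x : ℝ) : ℝ := (x ^ 2 + w.b ^ 2) / w.b * deriv f x

/-- The operator `∂ = e^{d-a} ∂ₓ = e^{2d} ∂ₓ`. -/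
def D (f : ℝ → ℝ) (x : ℝ) : ℝ := Real.exp (2 * w.d x) * deriv f x

/-! ## The master equation -/

/-- `F = 1 + (Λ² x/b + d_y) y / (1 + Λ²)`. -/
def F (x : ℝ) : ℝ := 1 + (w.Lsq * (x / w.b) + w.dy w.d x) * w.y x / (1 + w.Lsq)

/-- The first component of the static solution `(G, H)` of the pulsation system. -/
def G (x : ℝ) : ℝ := Real.exp (-w.c x) * (w.Lsq / (1 + w.Lsq) * (1 + x / w.b * w.y x))

/-- The second component of the static solution `(G, H)` of the pulsation system. -/
def H (x : ℝ) : ℝ := Real.exp (-w.c x) * w.F x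

/-- The potential of the regular master equation `χ_tt - ∂²χ + W χ = 0`.  The factor `b²` restores
the units for `b ≠ 1`, since `∂ = b e^{-2c} ∂_y`. -/
def W (x : ℝ) : ℝ :=
  w.b ^ 2 * Real.exp (-4 * w.c x) *
    (-3 * (1 + w.Lsq) + 2 * w.dy w.d x * (w.dy w.d x - w.dy w.c x)
      - 4 * (w.G x / w.H x) * (w.dy w.c x * w.dy w.d x + 1 + w.Lsq)
      + 2 * (w.dy w.c x) ^ 2 * (w.G x / w.H x) ^ 2)

/-- `χ` is a (classical) solution of `-∂²χ + W χ = E χ` on the real line. -/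
def IsStationary (E : ℝ) (χ : ℝ → ℝ) : Prop :=
  ContDiff ℝ 2 χ ∧ ∀ x, -w.D (w.D χ) x + w.W x * χ x = E * χ x

/-- Square integrability with respect to `e^{-2d} dx`. -/
def SquareIntegrable (f : ℝ → ℝ) : Prop :=
  MeasureTheory.Integrable (fun x => f x ^ 2 * Real.exp (-2 * w.d x)) MeasureTheory.volume

/-- `χ` is a bound state of energy `E` of `-∂² + W` on `L²(ℝ, e^{-2d} dx)`. -/
def IsBoundState (E : ℝ) (χ : ℝ → ℝ) : Prop :=
  w.IsStationary E χ ∧ w.SquareIntegrable χ ∧ ∃ x, χ x ≠ 0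

/-- The zero mode `χ₀ = c_y / (e^c F)`. -/
def zeroMode (x : ℝ) : ℝ := w.dy w.c x / (Real.exp (w.c x) * w.F x)

/-! ## Gauge-invariant perturbation quantities and growing modes -/

/-- `A = δa - e^{-a} (e^a δΦ / Φₓ)ₓ`. -/
def gaugeA (δ : Fields) (t x : ℝ) : ℝ :=
  δ.a t x - Real.exp (-w.background.a t x) *
    px (fun t x => Real.exp (w.background.a t x) * (δ.Φ t x / px w.background.Φ t x)) t x

/-- `C = δc - cₓ δΦ / Φₓ`. -/
def gaugeC (δ : Fields) (t x : ℝ) : ℝ :=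
  δ.c t x - px w.background.c t x * (δ.Φ t x / px w.background.Φ t x)

/-- `u₁ = e^{-c} (A - C)`. -/
def u₁ (δ : Fields) (t x : ℝ) : ℝ := Real.exp (-w.c x) * (w.gaugeA δ t x - w.gaugeC δ t x)

/-- `u₂ = e^{-c} C`. -/
def u₂ (δ : Fields) (t x : ℝ) : ℝ := Real.exp (-w.c x) * w.gaugeC δ t x

/-- The master field `χ = u₁ - (G / H) u₂`. -/
def masterField (δ : Fields) (t x : ℝ) : ℝ := w.u₁ δ t x - w.G x / w.H x * w.u₂ δ t x

/-- `f(t, x) = e^{βt} g(x)` with `g` smooth. -/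
def IsExponential (β : ℝ) (f : ℝ → ℝ → ℝ) : Prop :=
  ∃ g : ℝ → ℝ, ContDiff ℝ ((⊤ : ℕ∞) : WithTop ℕ∞) g ∧ ∀ t x, f t x = Real.exp (β * t) * g x

/-- `δ` is a mode of the linearized field equations proportional to `e^{βt}` which is smooth, is not
pure gauge, and whose gauge-invariant amplitudes are square integrable in space. -/
def IsMode (β : ℝ) (δ : Fields) : Prop :=
  IsExponential β δ.d ∧ IsExponential β δ.a ∧ IsExponential β δ.c ∧ IsExponential β δ.Φ ∧
  SolvesLinearizedEquations κ₀ κ w.Qsq w.background δ ∧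
  (∀ t, w.SquareIntegrable (w.u₁ δ t) ∧ w.SquareIntegrable (w.u₂ δ t)) ∧
  ∃ t x, w.u₁ δ t x ≠ 0 ∨ w.u₂ δ t x ≠ 0

end Wormhole

end ChargedWormhole

end

/-! ### Globally Lipschitz equations on the whole line. -/

namespace SturmSystem

open Function BoundedContinuousFunction

/-! With v = ∂χ, weight p = e^{-2d} and l = -E, the stationary equation becomes the first-order
system u' = p v, v' = p (W + l) u. At criticality p lies between positive constants and W is bounded
and tends to 0 at both ends. The zero mode solves the system at l = 0. It is bounded, has a single
simple zero x₀, and stays away from 0 near both ends, so it is a threshold resonance with one node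
(`IsCritical.exists_threshold`). One node at threshold forces exactly one bound state below it.

Uniqueness: by Sturm comparison with the zero mode (`IsThreshold.sturm`), a nontrivial solution with
l ≥ 0 that vanishes at or beyond x₀ stays bounded away from 0 at infinity. Hence bound states have
no zeros. The Wronskian of two of them tends to 0 at both ends, and for different energies it would
be strictly monotone, so the energies agree. A combination vanishing at x₀ is then zero
(`bound_state_unique`).

Existence: at l = 0 the solution with data (1, 0) at x₀ becomes negative on each side of x₀, because
its quotient by the bounded zero mode decreases at least linearly (`IsThreshold.exists_neg`). This
persists for some l₁ > 0, whereas for B > sup |W| the same solution is positive. The intermediate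
value theorem gives Dirichlet eigenvalues in [l₁, B] on the intervals [x₀ - n, x₀ + n]
(`exists_dirichlet`). A compactness limit of the eigenfunctions satisfies uv ≤ 0 in the tail, and
-uv in the left tail, which forces square integrability of both u and v = ∂u (`IsSol.decay`,
`exists_bound_state`).

The growing mode is built in the gauge δΦ = 0, with δa - δc = e^c χ and δd = δa - 2δc, so that the
linearized scalar wave equation is trivial. The momentum constraint turns the second evolution
equation into an algebraic formula for δc in terms of χ and ∂χ (`modeC`). The other equations are
then rational identities in x and the profile P (`IsCritical.mode_solves`). Since G = 0 at
criticality, the master field is u₁ = e^{βt} χ, and u₂ is dominated by |χ| + |∂χ|. -/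

lemma abs_integral_cosh_le {L : ℝ} (hL : 0 < L) (x₀ x : ℝ) :
    |∫ s in x₀..x, Real.cosh (L * (s - x₀))| ≤ Real.cosh (L * (x - x₀)) / L := by
  have h : ∫ s in x₀..x, Real.cosh (L * (s - x₀)) = Real.sinh (L * (x - x₀)) / L := by
    rw [intervalIntegral.integral_eq_sub_of_hasDerivAt
      (f := fun s => Real.sinh (L * (s - x₀)) / L)]
    · simp
    · intro s _
      have : HasDerivAt (fun s => L * (s - x₀)) L s := by
        simpa using ((hasDerivAt_id s).sub_const x₀).const_mul L
      simpa [hL.ne'] using this.sinh.div_const L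
    · exact Continuous.intervalIntegrable (by fun_prop) _ _
  rw [h, abs_div, abs_of_pos hL, Real.abs_sinh]
  gcongr
  rw [← Real.cosh_abs]
  exact (Real.sinh_lt_cosh _).le.trans (by rw [abs_mul])

/-- Global solvability of a globally Lipschitz equation, with continuous dependence on
a parameter. -/
theorem exists_global_solution {Λ E : Type*} [TopologicalSpace Λ] [NormedAddCommGroup E]
    [NormedSpace ℝ E] [CompleteSpace E] (f : Λ → ℝ → E → E)
    (hf : Continuous fun q : Λ × ℝ × E => f q.1 q.2.1 q.2.2) (h0 : ∀ l x, f l x 0 = 0)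
    (K : ℝ) (hK : ∀ l x y z, ‖f l x y - f l x z‖ ≤ K * ‖y - z‖) (x₀ : ℝ) (Y₀ : E) :
    ∃ Y : Λ → ℝ → E, Continuous (uncurry Y) ∧
      ∀ l, Y l x₀ = Y₀ ∧ ∀ x, HasDerivAt (Y l) (f l x (Y l x)) x := by
  wlog hKpos : 0 < K generalizing K
  · exact this 1 (fun l x y z => (hK l x y z).trans (by gcongr; linarith)) one_pos
  -- The unknown is Z = Y / cosh (L (x - x₀)), taken bounded. Integrating the cosh costs a factor
  -- 1/L, so the Picard map has Lipschitz constant K/L = 1/2 on the whole line at once.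
  set L := 2 * K with hLdef
  have hL : 0 < L := by positivity
  set c : ℝ → ℝ := fun x => Real.cosh (L * (x - x₀)) with hc
  have hcc : Continuous c := by fun_prop
  have hc1 : ∀ x, 1 ≤ c x := fun x => Real.one_le_cosh _
  have hc0 : ∀ x, 0 < c x := fun x => Real.cosh_pos _
  -- Parameter and position are treated together, so the fixed point is jointly continuous without a
  -- separate argument.
  let X := (Λ × ℝ) →ᵇ E
  have hint : ∀ Z : X, Continuous fun q : Λ × ℝ => f q.1 q.2 (c q.2 • Z q) := fun Z =>
    hf.comp (by fun_prop : Continuous fun q : Λ × ℝ => (q.1, q.2, c q.2 • Z q))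
  have hintl : ∀ (Z : X) (l : Λ), Continuous fun s => f l s (c s • Z (l, s)) := fun Z l =>
    (hint Z).comp (by fun_prop : Continuous fun s : ℝ => (l, s))
  let I : X → Λ × ℝ → E := fun Z q => Y₀ + ∫ s in x₀..q.2, f q.1 s (c s • Z (q.1, s))
  have hIc : ∀ Z, Continuous (I Z) := fun Z => by
    refine continuous_const.add ?_
    refine intervalIntegral.continuous_parametric_intervalIntegral_of_continuous
      (f := fun (q : Λ × ℝ) s => f q.1 s (c s • Z (q.1, s))) ?_ continuous_snd
    exact (hint Z).comp (by fun_prop : Continuous fun q : (Λ × ℝ) × ℝ => (q.1.1, q.2))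
  have hbound : ∀ (g : ℝ → E) (M : ℝ), 0 ≤ M → (∀ s, ‖g s‖ ≤ K * M * c s) →
      ∀ x, ‖(c x)⁻¹ • ∫ s in x₀..x, g s‖ ≤ 1 / 2 * M := by
    intro g M hM hg x
    have h1 : ‖∫ s in x₀..x, g s‖ ≤ |∫ s in x₀..x, K * M * c s| := by
      apply intervalIntegral.norm_integral_le_abs_of_norm_le
      · exact Filter.Eventually.of_forall fun s => hg s
      · exact Continuous.intervalIntegrable (by fun_prop) _ _
    rw [intervalIntegral.integral_const_mul, abs_mul, abs_of_nonneg (by positivity : 0 ≤ K * M)]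
      at h1
    have h2 := abs_integral_cosh_le hL x₀ x
    rw [norm_smul, norm_inv, Real.norm_of_nonneg (hc0 x).le, inv_mul_le_iff₀ (hc0 x)]
    calc _ ≤ _ := h1
      _ ≤ K * M * (c x / L) := by gcongr
      _ = _ := by rw [hLdef]; field_simp
  let Φ : X → X := fun Z => BoundedContinuousFunction.ofNormedAddCommGroup
    (fun q => (c q.2)⁻¹ • I Z q)
    (((hcc.comp continuous_snd).inv₀ fun q => (hc0 _).ne').smul (hIc Z))
    (‖Y₀‖ + 1 / 2 * ‖Z‖) (by
      intro q
      simp only [I, smul_add]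
      refine (norm_add_le _ _).trans (add_le_add ?_ ?_)
      · rw [norm_smul, norm_inv, Real.norm_of_nonneg (hc0 _).le]
        exact (mul_le_mul_of_nonneg_right (inv_le_one_of_one_le₀ (hc1 _))
          (norm_nonneg _)).trans (one_mul _).le
      · refine hbound _ _ (norm_nonneg _) (fun s => ?_) _
        have := hK q.1 s (c s • Z (q.1, s)) 0
        rw [h0, sub_zero, sub_zero, norm_smul, Real.norm_of_nonneg (hc0 s).le] at this
        refine this.trans ?_
        have := Z.norm_coe_le_norm (q.1, s)
        rw [mul_assoc, mul_comm ‖Z‖]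
        gcongr)
  have hΦ : ContractingWith (1 / 2) Φ := by
    refine ⟨by rw [← NNReal.coe_lt_coe]; norm_num, LipschitzWith.of_dist_le_mul fun Z Z' => ?_⟩
    rw [BoundedContinuousFunction.dist_le (by positivity)]
    intro q
    have : Φ Z q - Φ Z' q = (c q.2)⁻¹ • ∫ s in x₀..q.2,
        (f q.1 s (c s • Z (q.1, s)) - f q.1 s (c s • Z' (q.1, s))) := by
      rw [intervalIntegral.integral_sub ((hintl Z _).intervalIntegrable _ _)
        ((hintl Z' _).intervalIntegrable _ _)]
      change (c q.2)⁻¹ • I Z q - (c q.2)⁻¹ • I Z' q = _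
      rw [← smul_sub, add_sub_add_left_eq_sub]
    rw [dist_eq_norm, this]
    have h := hbound (fun s => f q.1 s (c s • Z (q.1, s)) - f q.1 s (c s • Z' (q.1, s)))
      (dist Z Z') dist_nonneg (fun s => ?_) q.2
    · simpa using h
    · refine (hK _ _ _ _).trans ?_
      rw [← smul_sub, norm_smul, Real.norm_of_nonneg (hc0 s).le, mul_assoc, mul_comm (dist Z Z'),
        ← dist_eq_norm]
      have := Z.dist_coe_le_dist (g := Z') (q.1, s)
      gcongr
  obtain ⟨Z, hZ⟩ : ∃ Z, Φ Z = Z := ⟨_, hΦ.fixedPoint_isFixedPt⟩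
  have hZI : ∀ l x, c x • Z (l, x) = Y₀ + ∫ s in x₀..x, f l s (c s • Z (l, s)) := by
    intro l x
    have : Z (l, x) = (c x)⁻¹ • I Z (l, x) := by
      conv_lhs => rw [← hZ]
      rfl
    rw [this, smul_inv_smul₀ (hc0 x).ne']
  refine ⟨fun l x => c x • Z (l, x), ?_, fun l => ⟨?_, fun x => ?_⟩⟩
  · exact (hcc.comp continuous_snd).smul Z.continuous
  · exact (hZI l x₀).trans (by rw [intervalIntegral.integral_same, add_zero])
  · have := (intervalIntegral.integral_hasDerivAt_right ((hintl Z l).intervalIntegrable x₀ x)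
      ((hintl Z l).stronglyMeasurableAtFilter _ _) (hintl Z l).continuousAt).const_add Y₀
    exact this.congr_of_eventuallyEq (Filter.Eventually.of_forall fun s => hZI l s)

end SturmSystem

/-! ### Sturm comparison, nodes and decay. -/

namespace SturmSystem

open Filter Topology Set MeasureTheory

/-- `u' = p v`, `v' = p (W + l) u`. -/
structure IsSol (p W : ℝ → ℝ) (l : ℝ) (u v : ℝ → ℝ) : Prop where
  du : ∀ x, HasDerivAt u (p x * v x) x
  dv : ∀ x, HasDerivAt v (p x * ((W x + l) * u x)) x

/-- Standing assumptions on the coefficients of the system. -/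
structure Bounds (p W : ℝ → ℝ) (p₁ p₂ M : ℝ) : Prop where
  cont_p : Continuous p
  cont_W : Continuous W
  pos : 0 < p₁
  le_p : ∀ x, p₁ ≤ p x
  p_le : ∀ x, p x ≤ p₂
  abs_W_le : ∀ x, |W x| ≤ M

/-- A bounded solution for `l = 0` with a simple zero at `x₀`, positive to its right and bounded
away from zero near infinity. -/
structure IsThreshold (p W : ℝ → ℝ) (x₀ : ℝ) (z zv : ℝ → ℝ) : Prop where
  sol : IsSol p W 0 z zv
  zero : z x₀ = 0
  deriv_pos : 0 < zv x₀
  pos : ∀ x, x₀ < x → 0 < z x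
  bdd : ∃ Z, ∀ x, |z x| ≤ Z
  away : ∃ c, 0 < c ∧ ∀ᶠ x in atTop, c ≤ z x

variable {p W : ℝ → ℝ} {p₁ p₂ M l l₁ l₂ x₀ x₁ X k : ℝ} {u v u₁ v₁ u₂ v₂ z zv : ℝ → ℝ}

namespace Bounds

lemma p_pos (hB : Bounds p W p₁ p₂ M) (x : ℝ) : 0 < p x := hB.pos.trans_le (hB.le_p x)

lemma neg (hB : Bounds p W p₁ p₂ M) :
    Bounds (fun x => p (-x)) (fun x => W (-x)) p₁ p₂ M where
  cont_p := hB.cont_p.comp continuous_neg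
  cont_W := hB.cont_W.comp continuous_neg
  pos := hB.pos
  le_p _ := hB.le_p _
  p_le _ := hB.p_le _
  abs_W_le _ := hB.abs_W_le _

end Bounds

namespace IsSol

lemma cont_u (h : IsSol p W l u v) : Continuous u :=
  continuous_iff_continuousAt.2 fun x => (h.du x).continuousAt

lemma cont_v (h : IsSol p W l u v) : Continuous v :=
  continuous_iff_continuousAt.2 fun x => (h.dv x).continuousAt

lemma lin (h₁ : IsSol p W l u₁ v₁) (h₂ : IsSol p W l u₂ v₂) (a b : ℝ) :
    IsSol p W l (fun x => a * u₁ x + b * u₂ x) (fun x => a * v₁ x + b * v₂ x) where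
  du x := (((h₁.du x).const_mul a).add ((h₂.du x).const_mul b)).congr_deriv (by ring)
  dv x := (((h₁.dv x).const_mul a).add ((h₂.dv x).const_mul b)).congr_deriv (by ring)

lemma neg (h : IsSol p W l u v) : IsSol p W l (fun x => -u x) (fun x => -v x) where
  du x := (h.du x).neg.congr_deriv (by ring)
  dv x := (h.dv x).neg.congr_deriv (by ring)

lemma reflect (h : IsSol p W l u v) :
    IsSol (fun x => p (-x)) (fun x => W (-x)) l (fun x => u (-x)) (fun x => -v (-x)) where
  du x := ((h.du (-x)).comp x (hasDerivAt_neg x)).congr_deriv (by ring)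
  dv x := ((h.dv (-x)).comp x (hasDerivAt_neg x)).neg.congr_deriv (by ring)

/-- At equal l the Wronskian is constant. At different l its derivative has a fixed sign wherever u₁
and u₂ have no zeros. -/
lemma wronskian (h₁ : IsSol p W l₁ u₁ v₁) (h₂ : IsSol p W l₂ u₂ v₂) (x : ℝ) :
    HasDerivAt (fun x => u₁ x * v₂ x - u₂ x * v₁ x) (p x * ((l₂ - l₁) * (u₁ x * u₂ x))) x :=
  (((h₁.du x).mul (h₂.dv x)).sub ((h₂.du x).mul (h₁.dv x))).congr_deriv (by ring)

lemma hasDerivAt_mul (h : IsSol p W l u v) (x : ℝ) :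
    HasDerivAt (fun x => u x * v x) (p x * (v x ^ 2 + (W x + l) * u x ^ 2)) x :=
  ((h.du x).mul (h.dv x)).congr_deriv (by ring)

lemma hasDerivAt_sq (h : IsSol p W l u v) (x : ℝ) :
    HasDerivAt (fun x => u x ^ 2) (2 * p x * (u x * v x)) x :=
  ((h.du x).pow 2).congr_deriv (by ring)

lemma hasDerivAt_sq' (h : IsSol p W l u v) (x : ℝ) :
    HasDerivAt (fun x => v x ^ 2) (2 * p x * ((W x + l) * (u x * v x))) x :=
  ((h.dv x).pow 2).congr_deriv (by ring)

lemma eq_zero (hB : Bounds p W p₁ p₂ M) (h : IsSol p W l u v) (hu : u x₀ = 0) (hv : v x₀ = 0)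
    (x : ℝ) : u x = 0 ∧ v x = 0 := by
  have hp2 : 0 ≤ p₂ := (hB.p_pos 0).le.trans (hB.p_le 0)
  have hM : 0 ≤ M := (abs_nonneg _).trans (hB.abs_W_le 0)
  have key := ODE_solution_unique_univ (t₀ := x₀) (f := fun x => (u x, v x))
    (g := fun _ => ((0, 0) : ℝ × ℝ)) (s := fun _ => univ)
    (v := fun x q => (p x * q.2, p x * ((W x + l) * q.1)))
    (K := ⟨p₂ * (1 + (M + |l|)), by positivity⟩) (fun t => ?_)
    (fun t => ⟨(h.du t).prodMk (h.dv t), mem_univ _⟩)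
    (fun t => ⟨(hasDerivAt_const t ((0, 0) : ℝ × ℝ)).congr_deriv (by ext <;> simp), mem_univ _⟩)
    (by simp [hu, hv])
  · have := congrFun key x
    simpa using this
  · refine LipschitzOnWith.of_dist_le_mul fun y _ y' _ => ?_
    have e1 : |y.1 - y'.1| ≤ dist y y' := by
      rw [← Real.dist_eq]; exact le_max_left _ _
    have e2 : |y.2 - y'.2| ≤ dist y y' := by
      rw [← Real.dist_eq]; exact le_max_right _ _
    have hpa : |p t| ≤ p₂ := by rw [abs_of_pos (hB.p_pos t)]; exact hB.p_le t
    have hWl : |W t + l| ≤ M + |l| :=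
      (abs_add_le _ _).trans (add_le_add (hB.abs_W_le t) le_rfl)
    rw [Prod.dist_eq]
    simp only [Real.dist_eq]
    rw [← mul_sub, ← mul_sub, ← mul_sub, abs_mul, abs_mul, abs_mul]
    have hd : 0 ≤ dist y y' := dist_nonneg
    refine max_le ?_ ?_
    · calc |p t| * |y.2 - y'.2| ≤ p₂ * dist y y' := by gcongr
        _ ≤ p₂ * (1 + (M + |l|)) * dist y y' := by
          have : 0 ≤ p₂ * (M + |l|) * dist y y' := by positivity
          linarith
    · calc |p t| * (|W t + l| * |y.1 - y'.1|) ≤ p₂ * ((M + |l|) * dist y y') := by gcongr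
        _ ≤ p₂ * (1 + (M + |l|)) * dist y y' := by
          have : 0 ≤ p₂ * dist y y' := by positivity
          linarith

end IsSol

lemma monotoneOn_Ici_of_hasDerivAt {f f' : ℝ → ℝ} {a : ℝ} (hf : ∀ x, a ≤ x → HasDerivAt f (f' x) x)
    (h0 : ∀ x, a ≤ x → 0 ≤ f' x) : MonotoneOn f (Ici a) := by
  refine monotoneOn_of_deriv_nonneg (convex_Ici a)
    (fun x hx => (hf x hx).continuousAt.continuousWithinAt)
    (fun x hx => ?_) (fun x hx => ?_)
  · rw [interior_Ici] at hx
    exact (hf x hx.le).differentiableAt.differentiableWithinAt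
  · rw [interior_Ici] at hx
    rw [(hf x hx.le).deriv]
    exact h0 x hx.le

lemma IsSol.hasDerivAt_div (h₁ : IsSol p W l₁ u₁ v₁) (h₂ : IsSol p W l₂ u₂ v₂) {x : ℝ}
    (hx : u₂ x ≠ 0) :
    HasDerivAt (fun x => u₁ x / u₂ x) (p x * (u₂ x * v₁ x - u₁ x * v₂ x) / u₂ x ^ 2) x :=
  ((h₁.du x).div (h₂.du x) hx).congr_deriv (by ring)

/-- Sturm comparison with the threshold solution. -/
theorem IsThreshold.sturm (hB : Bounds p W p₁ p₂ M) (hz : IsThreshold p W x₀ z zv)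
    (h : IsSol p W l u v) (hl : 0 ≤ l) (hx : x₀ ≤ x₁) (hu : u x₁ = 0) (hv : 0 < v x₁) :
    (∀ x, x₁ < x → 0 < u x) ∧ ∃ c, 0 < c ∧ ∀ᶠ x in atTop, c ≤ u x := by
  have hzpos : ∀ x, x₁ < x → 0 < z x := fun x hx' => hz.pos x (hx.trans_lt hx')
  have hz1 : 0 ≤ z x₁ := by
    rcases hx.eq_or_lt with h | h
    · rw [← h, hz.zero]
    · exact (hz.pos _ h).le
  set w : ℝ → ℝ := fun x => z x * v x - u x * zv x with hw
  have hwd : ∀ x, HasDerivAt w (p x * ((l - 0) * (z x * u x))) x := hz.sol.wronskian h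
  have hw1 : 0 ≤ w x₁ := by simp only [hw, hu]; nlinarith
  obtain ⟨ε, hε, hvε⟩ : ∃ ε > 0, ∀ x ∈ Icc x₁ (x₁ + ε), 0 < v x := by
    have : ∀ᶠ x in 𝓝 x₁, 0 < v x := h.cont_v.continuousAt.eventually (lt_mem_nhds hv)
    obtain ⟨ε, hε, H⟩ := Metric.eventually_nhds_iff.1 this
    refine ⟨ε / 2, by positivity, fun x hx => H ?_⟩
    rw [Real.dist_eq, abs_of_nonneg (by linarith [hx.1])]
    linarith [hx.2]
  have hmono : StrictMonoOn u (Icc x₁ (x₁ + ε)) := by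
    refine strictMonoOn_of_deriv_pos (convex_Icc _ _) h.cont_u.continuousOn fun x hx => ?_
    rw [interior_Icc] at hx
    rw [(h.du x).deriv]
    exact mul_pos (hB.p_pos x) (hvε x (Ioo_subset_Icc_self hx))
  have hunear : ∀ x ∈ Ioc x₁ (x₁ + ε), 0 < u x := fun x hx => by
    rw [← hu]
    exact hmono (left_mem_Icc.2 (by linarith)) (Ioc_subset_Icc_self hx) hx.1
  have hwnear : ∀ x ∈ Ioc x₁ (x₁ + ε), 0 ≤ w x := fun x hx => by
    have : MonotoneOn w (Icc x₁ (x₁ + ε)) := by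
      refine monotoneOn_of_deriv_nonneg (convex_Icc _ _)
        (fun x _ => (hwd x).continuousAt.continuousWithinAt)
        (fun x _ => (hwd x).differentiableAt.differentiableWithinAt) fun x hx => ?_
      rw [interior_Icc] at hx
      rw [(hwd x).deriv]
      have := hunear x (Ioo_subset_Ioc_self hx)
      have := hzpos x hx.1
      have := hB.p_pos x
      rw [sub_zero]
      positivity
    exact hw1.trans (this (left_mem_Icc.2 (by linarith)) (Ioc_subset_Icc_self hx) hx.1.le)
  have hqd : ∀ x, x₁ < x → HasDerivAt (fun x => u x / z x) (p x * w x / z x ^ 2) x :=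
    fun x hx' => h.hasDerivAt_div hz.sol (hzpos x hx').ne'
  -- The derivative of w u / z is p (l u² + w² / z²) ≥ 0 whatever the sign of u. This replaces an
  -- argument at the first zero of u: the sign of w u / z makes (u / z)² nondecreasing, so u cannot
  -- return to 0.
  have hwq : ∀ x, x₁ < x → 0 ≤ w x * (u x / z x) := fun x hx' => by
    obtain ⟨t, ht1, ht2⟩ := exists_between (lt_min hx' (by linarith : x₁ < x₁ + ε))
    have htm : t ∈ Ioc x₁ (x₁ + ε) := ⟨ht1, ht2.le.trans (min_le_right _ _)⟩
    have hm : MonotoneOn (fun x => w x * (u x / z x)) (Ici t) := by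
      refine monotoneOn_Ici_of_hasDerivAt
        (f' := fun x => p x * (l * u x ^ 2 + w x ^ 2 / z x ^ 2)) (fun y hy => ?_) fun y hy => ?_
      · have hzy := (hzpos y (ht1.trans_le hy)).ne'
        refine ((hwd y).mul (hqd y (ht1.trans_le hy))).congr_deriv ?_
        field_simp
        ring
      · have := hB.p_pos y
        positivity
    refine le_trans (mul_nonneg (hwnear t htm) (div_nonneg (hunear t htm).le (hzpos t ht1).le))
      (hm self_mem_Ici (mem_Ici.2 (ht2.le.trans (min_le_left _ _))) (ht2.le.trans (min_le_left _ _)))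
  have hpos : ∀ x, x₁ < x → 0 < u x := fun x hx' => by
    obtain ⟨t, ht1, ht2⟩ := exists_between (lt_min hx' (by linarith : x₁ < x₁ + ε))
    have htm : t ∈ Ioc x₁ (x₁ + ε) := ⟨ht1, ht2.le.trans (min_le_right _ _)⟩
    have htx : t ≤ x := ht2.le.trans (min_le_left _ _)
    have hm : MonotoneOn (fun x => (u x / z x) ^ 2) (Ici t) := by
      refine monotoneOn_Ici_of_hasDerivAt
        (f' := fun x => 2 * (p x / z x ^ 2 * (w x * (u x / z x)))) (fun y hy => ?_) fun y hy => ?_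
      · exact ((hqd y (ht1.trans_le hy)).pow 2).congr_deriv (by ring)
      · have := hB.p_pos y
        have := hwq y (ht1.trans_le hy)
        positivity
    have hne : ∀ y, t ≤ y → u y ≠ 0 := fun y hy h0 => by
      have h1 := hm self_mem_Ici (mem_Ici.2 hy) hy
      have h2 : 0 < (u t / z t) ^ 2 := by
        have := hunear t htm
        have := hzpos t ht1
        positivity
      simp only [h0, zero_div, ne_eq, OfNat.ofNat_ne_zero, not_false_eq_true, zero_pow] at h1
      exact h2.not_ge h1
    by_contra hneg
    obtain ⟨y, hy, hy0⟩ := intermediate_value_Icc' htx h.cont_u.continuousOn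
      ⟨not_lt.1 hneg, (hunear t htm).le⟩
    exact hne y hy.1 hy0
  refine ⟨hpos, ?_⟩
  -- Now that u > 0, w ≥ 0 makes u / z itself nondecreasing, so u inherits the lower bound of z near
  -- infinity.
  have hw0 : ∀ x, x₁ ≤ x → 0 ≤ w x := fun x hx' => by
    refine hw1.trans ((monotoneOn_Ici_of_hasDerivAt (fun y _ => hwd y) fun y hy => ?_)
      self_mem_Ici (mem_Ici.2 hx') hx')
    rcases hy.eq_or_lt with rfl | hy
    · simp [hu]
    · have := hpos y hy
      have := hzpos y hy
      have := hB.p_pos y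
      rw [sub_zero]
      positivity
  obtain ⟨c, hc, hcz⟩ := hz.away
  have hx2 : x₁ < x₁ + 1 := by linarith
  have hq2 : 0 < u (x₁ + 1) / z (x₁ + 1) := div_pos (hpos _ hx2) (hzpos _ hx2)
  refine ⟨u (x₁ + 1) / z (x₁ + 1) * c, mul_pos hq2 hc, ?_⟩
  filter_upwards [hcz, eventually_ge_atTop (x₁ + 1)] with x hcx hxx
  have hm : MonotoneOn (fun x => u x / z x) (Ici (x₁ + 1)) := by
    refine monotoneOn_Ici_of_hasDerivAt (fun y hy => hqd y (hx2.trans_le hy)) fun y hy => ?_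
    have := hw0 y (hx2.le.trans hy)
    have := hB.p_pos y
    positivity
  have h1 := hm self_mem_Ici (mem_Ici.2 hxx) hxx
  have hzx := hzpos x (hx2.trans_le hxx)
  calc _ ≤ u x / z x * z x := mul_le_mul h1 hcx hc.le (hq2.le.trans h1)
    _ = u x := by field_simp

lemma not_integrableOn_of_le_sq (hB : Bounds p W p₁ p₂ M) {c a : ℝ} (hc : 0 < c)
    (h : ∀ᶠ x in atTop, c ≤ u x ^ 2) : ¬ IntegrableOn (fun x => p x * u x ^ 2) (Ioi a) := by
  intro hi
  obtain ⟨b, hb⟩ := eventually_atTop.1 h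
  have h1 : IntegrableOn (fun x => p x * u x ^ 2) (Ioi (max a b)) :=
    hi.mono_set (Ioi_subset_Ioi (le_max_left _ _))
  have h2 : IntegrableOn (fun _ : ℝ => p₁ * c) (Ioi (max a b)) := by
    refine Integrable.mono' h1 aestronglyMeasurable_const ?_
    filter_upwards [ae_restrict_mem measurableSet_Ioi] with x hx
    have hx : b ≤ x := (le_max_right _ _).trans (le_of_lt hx)
    have := hB.pos
    rw [Real.norm_of_nonneg (by positivity)]
    exact mul_le_mul (hB.le_p x) (hb x hx) hc.le (hB.p_pos x).le
  rw [integrableOn_const_iff] at h2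
  rcases h2 with h2 | h2
  · have := mul_pos hB.pos hc
    exact this.ne' (by simpa using h2)
  · simp at h2

/-- Where W + l ≥ 0 the product uv is nondecreasing, and (u²)' = 2p uv. Were uv positive at one
point, u² would be nondecreasing and positive from there on, against integrability. -/
lemma IsSol.mul_nonpos_of_integrableOn (hB : Bounds p W p₁ p₂ M) (h : IsSol p W l u v)
    (hq : ∀ x, X ≤ x → 0 ≤ W x + l) (hi : IntegrableOn (fun x => p x * u x ^ 2) (Ioi X))
    {x : ℝ} (hx : X ≤ x) : u x * v x ≤ 0 := by
  by_contra! hpos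
  have hm : MonotoneOn (fun x => u x * v x) (Ici X) :=
    monotoneOn_Ici_of_hasDerivAt (fun y _ => h.hasDerivAt_mul y) fun y hy => by
      have := hB.p_pos y
      have := hq y hy
      positivity
  have hm2 : MonotoneOn (fun x => u x ^ 2) (Ici x) :=
    monotoneOn_Ici_of_hasDerivAt (fun y _ => h.hasDerivAt_sq y) fun y hy => by
      have := hB.p_pos y
      have : 0 ≤ u y * v y := hpos.le.trans (hm (mem_Ici.2 hx) (mem_Ici.2 (hx.trans hy)) hy)
      positivity
  have hu : 0 < u x ^ 2 := by
    have : u x ≠ 0 := by rintro h0; simp [h0] at hpos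
    positivity
  refine not_integrableOn_of_le_sq hB hu ?_ hi
  filter_upwards [eventually_ge_atTop x] with y hy
  exact hm2 self_mem_Ici (mem_Ici.2 hy) hy

/-- Integrating (uv)' = p (v² + (W + l) u²) with uv ≤ 0 bounds the energy on [X, n] by -u(X) v(X),
uniformly in n. Then u² and v² are integrable together with their derivatives, so both tend to 0. -/
lemma IsSol.decay (hB : Bounds p W p₁ p₂ M) (h : IsSol p W l u v) (hk : 0 < k)
    (hq : ∀ x, X ≤ x → k ≤ W x + l) (huv : ∀ x, X ≤ x → u x * v x ≤ 0) :
    IntegrableOn (fun x => p x * u x ^ 2) (Ioi X) ∧ IntegrableOn (fun x => p x * v x ^ 2) (Ioi X) ∧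
      Tendsto u atTop (𝓝 0) ∧ Tendsto v atTop (𝓝 0) := by
  have cu := h.cont_u
  have cv := h.cont_v
  have cp := hB.cont_p
  have cW := hB.cont_W
  have hi : IntegrableOn (fun x => p x * (v x ^ 2 + (W x + l) * u x ^ 2)) (Ioi X) := by
    refine integrableOn_Ioi_of_intervalIntegral_norm_bounded (-(u X * v X)) X
      (b := fun n : ℝ => n) (l := atTop) (fun i => ?_) tendsto_id ?_
    · exact (Continuous.integrableOn_Icc (by fun_prop)).mono_set Ioc_subset_Icc_self
    · filter_upwards [eventually_ge_atTop X] with n hn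
      have : ∫ x in X..n, ‖p x * (v x ^ 2 + (W x + l) * u x ^ 2)‖
          = ∫ x in X..n, p x * (v x ^ 2 + (W x + l) * u x ^ 2) := by
        refine intervalIntegral.integral_congr fun x hx => Real.norm_of_nonneg ?_
        rw [uIcc_of_le hn] at hx
        have := hB.p_pos x
        have := hk.le.trans (hq x hx.1)
        positivity
      rw [this, intervalIntegral.integral_eq_sub_of_hasDerivAt (fun x _ => h.hasDerivAt_mul x)
        (Continuous.intervalIntegrable (by fun_prop) _ _)]
      linarith [huv n hn]
  have hiu : IntegrableOn (fun x => p x * u x ^ 2) (Ioi X) := by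
    refine Integrable.mono' (hi.const_mul k⁻¹)
      (Continuous.aestronglyMeasurable (by fun_prop)) ?_
    filter_upwards [ae_restrict_mem measurableSet_Ioi] with x hx
    have hp := hB.p_pos x
    have hqx := hq x (le_of_lt hx)
    rw [Real.norm_of_nonneg (by positivity), le_inv_mul_iff₀ hk]
    have : k * u x ^ 2 ≤ v x ^ 2 + (W x + l) * u x ^ 2 := by nlinarith [sq_nonneg (u x), sq_nonneg (v x)]
    nlinarith
  have hiv : IntegrableOn (fun x => p x * v x ^ 2) (Ioi X) := by
    refine Integrable.mono' hi (Continuous.aestronglyMeasurable (by fun_prop)) ?_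
    filter_upwards [ae_restrict_mem measurableSet_Ioi] with x hx
    have hp := hB.p_pos x
    have hqx := hq x (le_of_lt hx)
    rw [Real.norm_of_nonneg (by positivity)]
    have : v x ^ 2 ≤ v x ^ 2 + (W x + l) * u x ^ 2 := by nlinarith [sq_nonneg (u x), sq_nonneg (v x)]
    gcongr
  have hiu2 : IntegrableOn (fun x => u x ^ 2) (Ioi X) := by
    refine Integrable.mono' (hiu.const_mul p₁⁻¹)
      (Continuous.aestronglyMeasurable (by fun_prop)) (Eventually.of_forall fun x => ?_)
    rw [Real.norm_of_nonneg (by positivity), le_inv_mul_iff₀ hB.pos]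
    gcongr
    exact hB.le_p x
  have hiv2 : IntegrableOn (fun x => v x ^ 2) (Ioi X) := by
    refine Integrable.mono' (hiv.const_mul p₁⁻¹)
      (Continuous.aestronglyMeasurable (by fun_prop)) (Eventually.of_forall fun x => ?_)
    rw [Real.norm_of_nonneg (by positivity), le_inv_mul_iff₀ hB.pos]
    gcongr
    exact hB.le_p x
  have hdu : IntegrableOn (fun x => 2 * p x * (u x * v x)) (Ioi X) := by
    refine Integrable.mono' (hiu.add hiv) (Continuous.aestronglyMeasurable (by fun_prop))
      (Eventually.of_forall fun x => ?_)
    have hp := hB.p_pos x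
    rw [Real.norm_eq_abs, abs_mul, abs_of_pos (by positivity : 0 < 2 * p x), abs_mul]
    simp only [Pi.add_apply]
    rw [← sq_abs (u x), ← sq_abs (v x)]
    nlinarith [sq_nonneg (|u x| - |v x|)]
  have hdv : IntegrableOn (fun x => 2 * p x * ((W x + l) * (u x * v x))) (Ioi X) := by
    refine Integrable.mono' (hdu.norm.const_mul (M + |l|))
      (Continuous.aestronglyMeasurable (by fun_prop)) (Eventually.of_forall fun x => ?_)
    have hWl : |W x + l| ≤ M + |l| :=
      (abs_add_le _ _).trans (add_le_add (hB.abs_W_le x) le_rfl)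
    have : 2 * p x * ((W x + l) * (u x * v x)) = (W x + l) * (2 * p x * (u x * v x)) := by ring
    rw [this, norm_mul, Real.norm_eq_abs (W x + l)]
    gcongr
  have tu := tendsto_zero_of_hasDerivAt_of_integrableOn_Ioi (fun x _ => h.hasDerivAt_sq x) hdu hiu2
  have tv := tendsto_zero_of_hasDerivAt_of_integrableOn_Ioi (fun x _ => h.hasDerivAt_sq' x) hdv hiv2
  have key : ∀ f : ℝ → ℝ, Tendsto (fun x => f x ^ 2) atTop (𝓝 0) → Tendsto f atTop (𝓝 0) := by
    intro f hf
    rw [tendsto_zero_iff_abs_tendsto_zero]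
    simpa [Function.comp_def, Real.sqrt_sq_eq_abs] using hf.sqrt
  exact ⟨hiu, hiv, key _ tu, key _ tv⟩

lemma exists_nonneg_of_tendsto_zero (hW : Tendsto W atTop (𝓝 0)) (hl : 0 < l) :
    ∃ X, ∀ x, X ≤ x → l / 2 ≤ W x + l := by
  have : ∀ᶠ x in atTop, -(l / 2) < W x := hW.eventually (lt_mem_nhds (by linarith))
  obtain ⟨X, hX⟩ := eventually_atTop.1 this
  exact ⟨X, fun x hx => by linarith [hX x hx]⟩

lemma IsSol.tendsto_zero (hB : Bounds p W p₁ p₂ M) (hW : Tendsto W atTop (𝓝 0)) (hl : 0 < l)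
    (h : IsSol p W l u v) (hi : Integrable fun x => p x * u x ^ 2) :
    Tendsto u atTop (𝓝 0) ∧ Tendsto v atTop (𝓝 0) := by
  obtain ⟨X, hX⟩ := exists_nonneg_of_tendsto_zero hW hl
  have := h.decay hB (half_pos hl) hX fun x hx =>
    h.mul_nonpos_of_integrableOn hB (fun y hy => (half_pos hl).le.trans (hX y hy))
      hi.integrableOn hx
  exact this.2.2

/-- At a zero v ≠ 0, by uniqueness for the initial value problem. Sturm comparison applied to u or
-u then keeps u away from 0 at infinity, so it is not square integrable. -/
lemma IsThreshold.ne_zero (hB : Bounds p W p₁ p₂ M) (hz : IsThreshold p W x₀ z zv)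
    (hl : 0 ≤ l) (h : IsSol p W l u v) (hi : Integrable fun x => p x * u x ^ 2)
    (hne : ∃ x, u x ≠ 0) {x : ℝ} (hx : x₀ ≤ x) : u x ≠ 0 := by
  intro h0
  obtain ⟨y, hy⟩ := hne
  rcases lt_trichotomy (v x) 0 with hv | hv | hv
  · obtain ⟨c, hc, hcu⟩ := (hz.sturm hB h.neg hl hx (by simp [h0]) (neg_pos.2 hv)).2
    refine not_integrableOn_of_le_sq hB (a := 0) (u := u) (pow_pos hc 2) ?_ hi.integrableOn
    filter_upwards [hcu] with y hy
    nlinarith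
  · exact hy (h.eq_zero hB h0 hv y).1
  · obtain ⟨c, hc, hcu⟩ := (hz.sturm hB h hl hx h0 hv).2
    refine not_integrableOn_of_le_sq hB (a := 0) (u := u) (pow_pos hc 2) ?_ hi.integrableOn
    filter_upwards [hcu] with y hy
    nlinarith

/-- The Wronskian with z is the constant -zv(x₀), so (u / z)' = -p zv(x₀) / z². Since z is bounded
by Z this is at most -p₁ zv(x₀) / Z², and u / z decreases at least linearly. -/
lemma IsThreshold.exists_neg (hB : Bounds p W p₁ p₂ M) (hz : IsThreshold p W x₀ z zv)
    (h : IsSol p W 0 u v) (hu : u x₀ = 1) : ∃ x, x₀ < x ∧ u x < 0 := by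
  obtain ⟨Z, hZ⟩ := hz.bdd
  have hw : ∀ x, z x * v x - u x * zv x = -zv x₀ := fun x => by
    have := is_const_of_deriv_eq_zero (f := fun x => z x * v x - u x * zv x)
      (fun y => (hz.sol.wronskian h y).differentiableAt)
      (fun y => by rw [(hz.sol.wronskian h y).deriv]; ring) x x₀
    simp only [this, hz.zero, hu]
    ring
  have hZ0 : 0 < Z := (hz.pos (x₀ + 1) (by linarith)).trans_le ((le_abs_self _).trans (hZ _))
  set a := p₁ * zv x₀ / Z ^ 2 with ha
  have ha0 : 0 < a := by
    have := hB.pos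
    have := hz.deriv_pos
    positivity
  have hm : MonotoneOn (fun x => -(u x / z x) - a * x) (Ici (x₀ + 1)) := by
    refine monotoneOn_Ici_of_hasDerivAt (f' := fun x => p x * zv x₀ / z x ^ 2 - a)
      (fun y hy => ?_) fun y hy => ?_
    · have hzy := (hz.pos y (by linarith)).ne'
      have h1 := h.hasDerivAt_div hz.sol hzy
      rw [hw] at h1
      refine (h1.neg.sub ((hasDerivAt_id y).const_mul a)).congr_deriv (by ring)
    · have hzy := hz.pos y (by linarith)
      have h2 := (abs_of_pos hzy) ▸ hZ y
      rw [sub_nonneg, ha]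
      have := hB.pos
      have := hz.deriv_pos
      have := hB.le_p y
      have := hB.p_pos y
      gcongr
  set C := -(u (x₀ + 1) / z (x₀ + 1)) - a * (x₀ + 1) with hC
  obtain ⟨x, hx1, hx2⟩ : ∃ x, x₀ + 1 ≤ x ∧ -C / a < x :=
    ⟨max (x₀ + 1) (-C / a + 1), le_max_left _ _, by linarith [le_max_right (x₀ + 1) (-C / a + 1)]⟩
  refine ⟨x, by linarith, ?_⟩
  have h1 : C ≤ -(u x / z x) - a * x := hm self_mem_Ici (mem_Ici.2 hx1) hx1
  have hzx := hz.pos x (by linarith)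
  rw [div_lt_iff₀ ha0] at hx2
  have h3 : u x / z x < 0 := by linarith
  by_contra! h4
  exact absurd (div_nonneg h4 hzx.le) (not_le.2 h3)

/-- Once the cosine-like solution has become negative it stays negative. -/
lemma IsSol.neg_of_neg (hB : Bounds p W p₁ p₂ M) (h₁ : IsSol p W l u₁ v₁) (h₂ : IsSol p W l u₂ v₂)
    (hu₁ : u₁ x₀ = 1) (hu₂ : u₂ x₀ = 0) (hv₂ : v₂ x₀ = 1) (hpos : ∀ x, x₀ < x → 0 < u₂ x)
    (hx : x₀ < x₁) (hneg : u₁ x₁ < 0) {x : ℝ} (hxx : x₁ ≤ x) : u₁ x < 0 := by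
  have hw : ∀ x, u₁ x * v₂ x - u₂ x * v₁ x = 1 := fun x => by
    have := is_const_of_deriv_eq_zero (f := fun x => u₁ x * v₂ x - u₂ x * v₁ x)
      (fun y => (h₁.wronskian h₂ y).differentiableAt)
      (fun y => by rw [(h₁.wronskian h₂ y).deriv]; ring) x x₀
    simp only [this, hu₁, hu₂, hv₂]
    ring
  have hm : MonotoneOn (fun x => -(u₁ x / u₂ x)) (Ici x₁) := by
    refine monotoneOn_Ici_of_hasDerivAt (f' := fun x => p x / u₂ x ^ 2)
      (fun y hy => ?_) fun y hy => ?_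
    · refine (h₁.hasDerivAt_div h₂ (hpos y (hx.trans_le hy)).ne').neg.congr_deriv ?_
      have : u₂ y * v₁ y - u₁ y * v₂ y = -1 := by linarith [hw y]
      rw [this]
      ring
    · have := hB.p_pos y
      positivity
  have h1 := hm self_mem_Ici (mem_Ici.2 hxx) hxx
  have h2 := div_neg_of_neg_of_pos hneg (hpos x₁ hx)
  simp only [neg_le_neg_iff] at h1
  by_contra! h4
  linarith [div_nonneg h4 (hpos x (hx.trans_le hxx)).le]

/-- The product uv starts at 0 and is nondecreasing, so u² never falls below its initial value 1. -/
lemma IsSol.pos_of_nonneg (hB : Bounds p W p₁ p₂ M) (h : IsSol p W l u v) (hq : ∀ x, 0 ≤ W x + l)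
    (hu : u x₀ = 1) (hv : v x₀ = 0) {x : ℝ} (hx : x₀ ≤ x) : 0 < u x := by
  have hm : MonotoneOn (fun x => u x * v x) (Ici x₀) :=
    monotoneOn_Ici_of_hasDerivAt (fun y _ => h.hasDerivAt_mul y) fun y hy => by
      have := hB.p_pos y
      have := hq y
      positivity
  have hm2 : MonotoneOn (fun x => u x ^ 2) (Ici x₀) :=
    monotoneOn_Ici_of_hasDerivAt (fun y _ => h.hasDerivAt_sq y) fun y hy => by
      have := hB.p_pos y
      have : 0 ≤ u y * v y := by simpa [hv] using hm self_mem_Ici (mem_Ici.2 hy) hy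
      positivity
  have hne : ∀ y, x₀ ≤ y → u y ≠ 0 := fun y hy h0 => by
    have h1 := hm2 self_mem_Ici (mem_Ici.2 hy) hy
    simp only [hu, h0] at h1
    norm_num at h1
  by_contra! hneg
  obtain ⟨y, hy, hy0⟩ := intermediate_value_Icc' hx h.cont_u.continuousOn
    ⟨hneg, hu.symm ▸ zero_le_one⟩
  exact hne y hy.1 hy0

/-- The product uv is nondecreasing on [X, ∞) and vanishes at x₁. This sign condition for Dirichlet
eigenfunctions survives a pointwise limit, which is how the limit solution acquires decay. -/
lemma IsSol.mul_nonpos_of_zero (hB : Bounds p W p₁ p₂ M) (h : IsSol p W l u v)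
    (hq : ∀ x, X ≤ x → 0 ≤ W x + l) (hu : u x₁ = 0) {x : ℝ} (hx : X ≤ x) (hx₁ : x ≤ x₁) :
    u x * v x ≤ 0 := by
  have hm : MonotoneOn (fun x => u x * v x) (Ici X) :=
    monotoneOn_Ici_of_hasDerivAt (fun y _ => h.hasDerivAt_mul y) fun y hy => by
      have := hB.p_pos y
      have := hq y hy
      positivity
  simpa [hu] using hm (mem_Ici.2 hx) (mem_Ici.2 (hx.trans hx₁)) hx₁

end SturmSystem

/-! ### Existence and uniqueness of the bound state. -/

namespace SturmSystem

open Filter Topology Set MeasureTheory Function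

variable {p W : ℝ → ℝ} {p₁ p₂ M l l₁ l₂ x₀ x₁ X k : ℝ} {u v u₁ v₁ u₂ v₂ z zv z' zv' : ℝ → ℝ}

/-- Solutions with given initial data, depending continuously on `l ∈ [0, B]`. -/
lemma Bounds.exists_family (hB : Bounds p W p₁ p₂ M) {B : ℝ} (hB0 : 0 ≤ B) (x₀ a b : ℝ) :
    ∃ u v : ℝ → ℝ → ℝ, Continuous (uncurry u) ∧ Continuous (uncurry v) ∧
      ∀ l ∈ Icc 0 B, IsSol p W l (u l) (v l) ∧ u l x₀ = a ∧ v l x₀ = b := by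
  have hp2 : 0 ≤ p₂ := (hB.p_pos 0).le.trans (hB.p_le 0)
  have hM : 0 ≤ M := (abs_nonneg _).trans (hB.abs_W_le 0)
  have cp := hB.cont_p
  have cW := hB.cont_W
  -- The parameter is clamped to [0, B], which gives one Lipschitz constant for all real l and
  -- changes nothing on the interval of interest.
  have hK : ∀ (l t : ℝ) (y y' : ℝ × ℝ),
      ‖((p t * y.2, p t * ((W t + max 0 (min l B)) * y.1)) : ℝ × ℝ)
        - (p t * y'.2, p t * ((W t + max 0 (min l B)) * y'.1))‖
        ≤ p₂ * (1 + (M + B)) * ‖y - y'‖ := by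
    intro l t y y'
    set c := max 0 (min l B) with hc
    have hc1 : |c| ≤ B := by
      rw [abs_of_nonneg (le_max_left _ _)]
      exact max_le hB0 (min_le_right _ _)
    have e1 : |y.1 - y'.1| ≤ ‖y - y'‖ := by
      rw [← Real.norm_eq_abs]; exact norm_fst_le (y - y')
    have e2 : |y.2 - y'.2| ≤ ‖y - y'‖ := by
      rw [← Real.norm_eq_abs]; exact norm_snd_le (y - y')
    have hpa : |p t| ≤ p₂ := by rw [abs_of_pos (hB.p_pos t)]; exact hB.p_le t
    have hWl : |W t + c| ≤ M + B := (abs_add_le _ _).trans (add_le_add (hB.abs_W_le t) hc1)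
    rw [Prod.norm_def]
    simp only [Prod.fst_sub, Prod.snd_sub, Real.norm_eq_abs]
    rw [← mul_sub, ← mul_sub, ← mul_sub, abs_mul, abs_mul, abs_mul]
    have hd : 0 ≤ ‖y - y'‖ := norm_nonneg _
    refine max_le ?_ ?_
    · calc |p t| * |y.2 - y'.2| ≤ p₂ * ‖y - y'‖ := by gcongr
        _ ≤ p₂ * (1 + (M + B)) * ‖y - y'‖ := by
          have : 0 ≤ p₂ * (M + B) * ‖y - y'‖ := by positivity
          linarith
    · calc |p t| * (|W t + c| * |y.1 - y'.1|) ≤ p₂ * ((M + B) * ‖y - y'‖) := by gcongr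
        _ ≤ p₂ * (1 + (M + B)) * ‖y - y'‖ := by
          have : 0 ≤ p₂ * ‖y - y'‖ := by positivity
          linarith
  obtain ⟨Y, hY, H⟩ := exists_global_solution (Λ := ℝ) (E := ℝ × ℝ)
    (fun l x q => (p x * q.2, p x * ((W x + max 0 (min l B)) * q.1))) (by fun_prop)
    (fun l x => by simp) (p₂ * (1 + (M + B))) hK x₀ (a, b)
  refine ⟨fun l x => (Y l x).1, fun l x => (Y l x).2, continuous_fst.comp hY,
    continuous_snd.comp hY, fun l hl => ⟨⟨fun x => ?_, fun x => ?_⟩, ?_, ?_⟩⟩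
  · exact ((H l).2 x).fst
  · have : HasDerivAt (fun x => (Y l x).2) (p x * ((W x + max 0 (min l B)) * (Y l x).1)) x :=
      ((H l).2 x).snd
    rwa [min_eq_left hl.2, max_eq_right hl.1] at this
  · simp [(H l).1]
  · simp [(H l).1]

lemma integrable_of_Ioi_of_neg {f : ℝ → ℝ} (hf : Continuous f) {a b : ℝ}
    (ha : IntegrableOn f (Ioi a)) (hb : IntegrableOn (fun x => f (-x)) (Ioi b)) :
    Integrable f := by
  have h1 : IntegrableOn f (Iio (-b)) := by
    have := (Measure.measurePreserving_neg (volume : Measure ℝ)).integrableOn_comp_preimage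
      (Homeomorph.neg ℝ).measurableEmbedding (f := f) (s := Iio (-b))
    refine this.1 ?_
    convert hb using 1
    all_goals ext x; simp
  have h2 : IntegrableOn f (Icc (-b) a) := hf.integrableOn_Icc
  rw [← integrableOn_univ]
  refine ((h1.union h2).union ha).mono_set fun x _ => ?_
  by_cases hx : x < -b
  · exact Or.inl (Or.inl hx)
  by_cases hx' : x ≤ a
  · exact Or.inl (Or.inr ⟨not_lt.1 hx, hx'⟩)
  · exact Or.inr (not_le.1 hx')

/-- For every large `n`, some `l` between `l₁` and `B` is a Dirichlet eigenvalue on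
`[x₀ - n, x₀ + n]`; the eigenvalues stay bounded and away from zero. -/
lemma exists_dirichlet (hB : Bounds p W p₁ p₂ M) (hz : IsThreshold p W x₀ z zv)
    (hz' : IsThreshold (fun x => p (-x)) (fun x => W (-x)) (-x₀) z' zv')
    {B : ℝ} (hBM : M < B) {T Tv S Sv : ℝ → ℝ → ℝ} (cT : Continuous (uncurry T))
    (cS : Continuous (uncurry S))
    (hT : ∀ l ∈ Icc 0 B, IsSol p W l (T l) (Tv l) ∧ T l x₀ = 1 ∧ Tv l x₀ = 0)
    (hS : ∀ l ∈ Icc 0 B, IsSol p W l (S l) (Sv l) ∧ S l x₀ = 0 ∧ Sv l x₀ = 1) :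
    ∃ l₁ n₀, 0 < l₁ ∧ l₁ ≤ B ∧ 0 < n₀ ∧ ∀ n, n₀ ≤ n → ∃ q : ℝ × ℝ × ℝ,
      q ∈ Icc l₁ B ×ˢ Metric.sphere (0 : ℝ × ℝ) 1 ∧
      q.2.1 * T q.1 (x₀ + n) + q.2.2 * S q.1 (x₀ + n) = 0 ∧
      q.2.1 * T q.1 (x₀ - n) + q.2.2 * S q.1 (x₀ - n) = 0 := by
  have hM : 0 ≤ M := (abs_nonneg _).trans (hB.abs_W_le 0)
  have hB0 : 0 < B := by linarith
  have hmem0 : (0 : ℝ) ∈ Icc 0 B := ⟨le_rfl, hB0.le⟩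
  have hmemB : B ∈ Icc 0 B := ⟨hB0.le, le_rfl⟩
  have cTx : ∀ x, Continuous fun l => T l x := fun x =>
    cT.comp (by fun_prop : Continuous fun l : ℝ => (l, x))
  have cSx : ∀ x, Continuous fun l => S l x := fun x =>
    cS.comp (by fun_prop : Continuous fun l : ℝ => (l, x))
  have SR : ∀ l ∈ Icc 0 B, ∀ x, x₀ < x → 0 < S l x := fun l hl =>
    (hz.sturm hB (hS l hl).1 hl.1 le_rfl (hS l hl).2.1 (by rw [(hS l hl).2.2]; exact one_pos)).1
  have SL : ∀ l ∈ Icc 0 B, ∀ x, -x₀ < x → 0 < -S l (-x) := fun l hl =>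
    (hz'.sturm hB.neg (hS l hl).1.reflect.neg hl.1 le_rfl (by simp [(hS l hl).2.1])
      (by simp [(hS l hl).2.2])).1
  obtain ⟨N, hN, hTN⟩ := hz.exists_neg hB (hT 0 hmem0).1 (hT 0 hmem0).2.1
  obtain ⟨N', hN', hTN'⟩ := hz'.exists_neg hB.neg (hT 0 hmem0).1.reflect
    (by simp [(hT 0 hmem0).2.1])
  -- Negativity of T at two fixed points is an open condition in l, so it extends from l = 0 to some
  -- l₁ > 0. This l₁ keeps the eigenvalues away from 0.
  obtain ⟨l₁, hl₁0, hl₁B, h1, h2⟩ : ∃ l₁, 0 < l₁ ∧ l₁ ≤ B ∧ T l₁ N < 0 ∧ T l₁ (-N') < 0 := by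
    have e : ∀ᶠ l in 𝓝 (0 : ℝ), T l N < 0 ∧ T l (-N') < 0 :=
      ((cTx N).continuousAt.eventually (gt_mem_nhds hTN)).and
        ((cTx (-N')).continuousAt.eventually (gt_mem_nhds hTN'))
    obtain ⟨ε, hε, H⟩ := Metric.eventually_nhds_iff.1 e
    refine ⟨min (ε / 2) B, by positivity, min_le_right _ _, H ?_⟩
    rw [Real.dist_eq, sub_zero, abs_of_pos (by positivity)]
    linarith [min_le_left (ε / 2) B]
  have hmem1 : l₁ ∈ Icc 0 B := ⟨hl₁0.le, hl₁B⟩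
  refine ⟨l₁, max (N - x₀) (N' + x₀), hl₁0, hl₁B, lt_max_of_lt_left (by linarith),
    fun n hn => ?_⟩
  have hn1 := (le_max_left _ _).trans hn
  have hn2 := (le_max_right _ _).trans hn
  have hq : ∀ x, 0 ≤ W x + B := fun x => by linarith [(abs_le.1 (hB.abs_W_le x)).1]
  have T1 : T l₁ (x₀ + n) < 0 := (hT l₁ hmem1).1.neg_of_neg hB (hS l₁ hmem1).1 (hT l₁ hmem1).2.1
    (hS l₁ hmem1).2.1 (hS l₁ hmem1).2.2 (SR l₁ hmem1) hN h1 (by linarith)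
  have T2 : T l₁ (x₀ - n) < 0 := by
    have := (hT l₁ hmem1).1.reflect.neg_of_neg hB.neg (x₀ := -x₀) (x := -x₀ + n)
      (hS l₁ hmem1).1.reflect.neg (by simp [(hT l₁ hmem1).2.1])
      (by simp [(hS l₁ hmem1).2.1]) (by simp [(hS l₁ hmem1).2.2]) (SL l₁ hmem1) hN' h2
      (by linarith)
    rwa [show -(-x₀ + n) = x₀ - n by ring] at this
  have T3 : 0 < T B (x₀ + n) := (hT B hmemB).1.pos_of_nonneg hB hq (hT B hmemB).2.1
    (hT B hmemB).2.2 (by linarith)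
  have T4 : 0 < T B (x₀ - n) := by
    have := (hT B hmemB).1.reflect.pos_of_nonneg hB.neg (x₀ := -x₀) (x := -x₀ + n)
      (fun x => hq (-x)) (by simp [(hT B hmemB).2.1]) (by simp [(hT B hmemB).2.2]) (by linarith)
    rwa [show -(-x₀ + n) = x₀ - n by ring] at this
  have S1 : ∀ l ∈ Icc 0 B, 0 < S l (x₀ + n) := fun l hl => SR l hl _ (by linarith)
  have S2 : ∀ l ∈ Icc 0 B, S l (x₀ - n) < 0 := fun l hl => by
    have := SL l hl (-x₀ + n) (by linarith)
    rw [show -(-x₀ + n) = x₀ - n by ring] at this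
    linarith
  -- The Dirichlet determinant changes sign: S has opposite signs at the two ends for every l, while
  -- T is negative at both ends for l₁ and positive at both for B.
  obtain ⟨l, hl, hl0⟩ := intermediate_value_Icc' hl₁B
    (f := fun l => T l (x₀ + n) * S l (x₀ - n) - T l (x₀ - n) * S l (x₀ + n))
    (((((cTx _).mul (cSx _)).sub ((cTx _).mul (cSx _)))).continuousOn) (show (0 : ℝ) ∈ _ from
      ⟨by nlinarith [S1 B hmemB, S2 B hmemB], by nlinarith [S1 l₁ hmem1, S2 l₁ hmem1]⟩)
  have hlm : l ∈ Icc 0 B := ⟨hl₁0.le.trans hl.1, hl.2⟩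
  -- These coefficients cancel the combination at the right end; the vanishing determinant cancels
  -- it at the left end.
  set y : ℝ × ℝ := (S l (x₀ + n), -T l (x₀ + n)) with hy
  have hy0 : y ≠ 0 := fun h => (S1 l hlm).ne' (congrArg Prod.fst h)
  refine ⟨(l, ‖y‖⁻¹ • y), ⟨hl, ?_⟩, ?_, ?_⟩
  · rw [mem_sphere_zero_iff_norm, norm_smul, norm_inv, norm_norm,
      inv_mul_cancel₀ (norm_ne_zero_iff.2 hy0)]
  · simp only [hy, Prod.smul_fst, Prod.smul_snd, smul_eq_mul]
    ring
  · simp only at hl0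
    simp only [hy, Prod.smul_fst, Prod.smul_snd, smul_eq_mul]
    linear_combination (-‖y‖⁻¹) * hl0

/-- Existence of a bound state of negative energy `-l`. -/
theorem exists_bound_state (hB : Bounds p W p₁ p₂ M) (hW : Tendsto W atTop (𝓝 0))
    (hW' : Tendsto (fun x => W (-x)) atTop (𝓝 0)) (hz : IsThreshold p W x₀ z zv)
    (hz' : IsThreshold (fun x => p (-x)) (fun x => W (-x)) (-x₀) z' zv') :
    ∃ l, 0 < l ∧ ∃ u v, IsSol p W l u v ∧ (Integrable fun x => p x * u x ^ 2) ∧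
      (Integrable fun x => p x * v x ^ 2) ∧ ∃ x, u x ≠ 0 := by
  have hM : 0 ≤ M := (abs_nonneg _).trans (hB.abs_W_le 0)
  obtain ⟨T, Tv, cT, cTv, hT⟩ := hB.exists_family (B := M + 1) (by linarith) x₀ 1 0
  obtain ⟨S, Sv, cS, cSv, hS⟩ := hB.exists_family (B := M + 1) (by linarith) x₀ 0 1
  obtain ⟨l₁, n₀, hl₁, hl₁B, hn₀, H⟩ := exists_dirichlet hB hz hz' (lt_add_one M) cT cS hT hS
  choose q hq hq1 hq2 using fun n : ℕ => H (n₀ + n) (by linarith [n.cast_nonneg (α := ℝ)])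
  -- Energies in [l₁, M + 1] and data at x₀ normalized to the unit sphere form a compact set. The
  -- limit therefore has l ≥ l₁ > 0 and nonzero data.
  obtain ⟨⟨l, α, σ⟩, hqm, φ, hφ, hlim⟩ :=
    (isCompact_Icc.prod (isCompact_sphere (0 : ℝ × ℝ) 1)).tendsto_subseq hq
  have hl : l ∈ Icc l₁ (M + 1) := hqm.1
  have hsub : ∀ t ∈ Icc l₁ (M + 1), t ∈ Icc 0 (M + 1) := fun t ht => ⟨hl₁.le.trans ht.1, ht.2⟩
  have hne : α ≠ 0 ∨ σ ≠ 0 := by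
    by_contra! h
    have h2 : ‖((α, σ) : ℝ × ℝ)‖ = 1 := by simpa using hqm.2
    rw [h.1, h.2] at h2
    simp at h2
  have hlp : 0 < l := hl₁.trans_le hl.1
  have hsol : ∀ r : ℝ × ℝ × ℝ, r.1 ∈ Icc l₁ (M + 1) → IsSol p W r.1
      (fun x => r.2.1 * T r.1 x + r.2.2 * S r.1 x)
      (fun x => r.2.1 * Tv r.1 x + r.2.2 * Sv r.1 x) := fun r hr =>
    (hT _ (hsub _ hr)).1.lin (hS _ (hsub _ hr)).1 _ _
  have hcont : ∀ x, Continuous fun r : ℝ × ℝ × ℝ =>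
      (r.2.1 * T r.1 x + r.2.2 * S r.1 x) * (r.2.1 * Tv r.1 x + r.2.2 * Sv r.1 x) := by
    intro x
    have a1 : Continuous fun r : ℝ × ℝ × ℝ => T r.1 x :=
      cT.comp (by fun_prop : Continuous fun r : ℝ × ℝ × ℝ => (r.1, x))
    have a2 : Continuous fun r : ℝ × ℝ × ℝ => S r.1 x :=
      cS.comp (by fun_prop : Continuous fun r : ℝ × ℝ × ℝ => (r.1, x))
    have a3 : Continuous fun r : ℝ × ℝ × ℝ => Tv r.1 x :=
      cTv.comp (by fun_prop : Continuous fun r : ℝ × ℝ × ℝ => (r.1, x))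
    have a4 : Continuous fun r : ℝ × ℝ × ℝ => Sv r.1 x :=
      cSv.comp (by fun_prop : Continuous fun r : ℝ × ℝ × ℝ => (r.1, x))
    fun_prop
  have hlim' := fun x => ((hcont x).tendsto _).comp hlim
  set u : ℝ → ℝ := fun x => α * T l x + σ * S l x with hu
  set v : ℝ → ℝ := fun x => α * Tv l x + σ * Sv l x with hv
  have huv : IsSol p W l u v := hsol (l, α, σ) hl
  have hev : ∀ y : ℝ, ∀ᶠ n in atTop, y ≤ n₀ + (φ n : ℕ) := fun y => by
    have := (tendsto_natCast_atTop_atTop (R := ℝ)).comp hφ.tendsto_atTop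
    filter_upwards [this.eventually_ge_atTop y] with n hn
    simp only [comp_apply] at hn
    linarith
  obtain ⟨X, hX⟩ := exists_nonneg_of_tendsto_zero hW hl₁
  obtain ⟨X', hX'⟩ := exists_nonneg_of_tendsto_zero hW' hl₁
  -- For fixed x in the tail, the eigenfunctions satisfy uv ≤ 0 at x as soon as the right endpoint
  -- passes x, and the inequality passes to the limit.
  have R := huv.decay hB (half_pos hl₁) (fun x hx => (hX x hx).trans (by linarith [hl.1]))
    fun x hx => by
      refine le_of_tendsto (hlim' x) ?_
      filter_upwards [hev (x - x₀)] with n hn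
      exact (hsol _ (hq _).1).mul_nonpos_of_zero hB (x₁ := x₀ + (n₀ + φ n))
        (fun y hy => (half_pos hl₁).le.trans ((hX y hy).trans (by linarith [(hq (φ n)).1.1])))
        (hq1 _) hx (by linarith)
  have R' := huv.reflect.decay hB.neg (half_pos hl₁)
    (fun x hx => (hX' x hx).trans (by linarith [hl.1])) fun x hx => by
      have hlm := (hlim' (-x)).neg
      have : u (-x) * -v (-x) = -(u (-x) * v (-x)) := by ring
      rw [this]
      refine le_of_tendsto hlm ?_
      filter_upwards [hev (x + x₀)] with n hn
      have := (hsol _ (hq (φ n)).1).reflect.mul_nonpos_of_zero hB.neg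
        (x₁ := -x₀ + (n₀ + φ n)) (X := X')
        (fun y hy => (half_pos hl₁).le.trans ((hX' y hy).trans (by linarith [(hq (φ n)).1.1])))
        (by rw [show -(-x₀ + (n₀ + (φ n : ℝ))) = x₀ - (n₀ + φ n) by ring]; exact hq2 _)
        hx (by linarith)
      rw [mul_neg] at this
      exact this
  have cu := huv.cont_u
  have cv := huv.cont_v
  have cp := hB.cont_p
  refine ⟨l, hlp, u, v, huv, integrable_of_Ioi_of_neg (by fun_prop) R.1 R'.1,
    integrable_of_Ioi_of_neg (by fun_prop) R.2.1 (by simpa only [neg_sq] using R'.2.1), ?_⟩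
  by_contra! h0
  have hv0 : ∀ x, v x = 0 := fun x => by
    have h1 := (huv.du x).unique ((hasDerivAt_const x (0 : ℝ)).congr_of_eventuallyEq
      (Eventually.of_forall h0))
    exact (mul_eq_zero.1 h1).resolve_left (hB.p_pos x).ne'
  have h1 := h0 x₀
  have h2 := hv0 x₀
  simp only [hu, hv, (hT l (hsub l hl)).2, (hS l (hsub l hl)).2] at h1 h2
  rcases hne with h | h
  · exact h (by linarith)
  · exact h (by linarith)

lemma forall_pos_or_forall_neg {f : ℝ → ℝ} (hf : Continuous f) (h : ∀ x, f x ≠ 0) :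
    (∀ x, 0 < f x) ∨ ∀ x, f x < 0 := by
  by_contra! hcon
  obtain ⟨⟨a, ha⟩, b, hb⟩ := hcon
  obtain ⟨c, hc⟩ := mem_range_of_exists_le_of_exists_ge hf ⟨a, ha⟩ ⟨b, hb⟩
  exact h c hc

lemma not_forall_hasDerivAt_pos {f f' : ℝ → ℝ} (hf : ∀ x, HasDerivAt f (f' x) x)
    (htop : Tendsto f atTop (𝓝 0)) (hbot : Tendsto (fun x => f (-x)) atTop (𝓝 0)) :
    ¬ ∀ x, 0 < f' x := by
  intro h
  have hm : StrictMono f := strictMono_of_deriv_pos fun x => by rw [(hf x).deriv]; exact h x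
  have h1 : f 1 ≤ 0 := hm.monotone.ge_of_tendsto htop 1
  have h2 : 0 ≤ f 0 := by
    have : Antitone fun x => f (-x) := fun a b hab => hm.monotone (neg_le_neg hab)
    simpa using this.le_of_tendsto hbot 0
  linarith [hm (zero_lt_one (α := ℝ))]

/-- Comparison with the threshold solution on the right of x₀, and with its reflection on the left,
shows that bound states have no zeros. Two different energies would then give a strictly monotone
Wronskian tending to 0 at both ends. -/
theorem bound_state_unique (hB : Bounds p W p₁ p₂ M) (hW : Tendsto W atTop (𝓝 0))
    (hW' : Tendsto (fun x => W (-x)) atTop (𝓝 0)) (hz : IsThreshold p W x₀ z zv)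
    (hz' : IsThreshold (fun x => p (-x)) (fun x => W (-x)) (-x₀) z' zv')
    (hl₁ : 0 < l₁) (hl₂ : 0 < l₂) (h₁ : IsSol p W l₁ u₁ v₁) (h₂ : IsSol p W l₂ u₂ v₂)
    (hi₁ : Integrable fun x => p x * u₁ x ^ 2) (hi₂ : Integrable fun x => p x * u₂ x ^ 2)
    (hne₁ : ∃ x, u₁ x ≠ 0) (hne₂ : ∃ x, u₂ x ≠ 0) :
    l₁ = l₂ ∧ ∃ k, ∀ x, u₁ x = k * u₂ x := by
  have nodeless : ∀ {l : ℝ} {u v : ℝ → ℝ}, 0 < l → IsSol p W l u v →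
      (Integrable fun x => p x * u x ^ 2) → (∃ x, u x ≠ 0) → ∀ x, u x ≠ 0 := by
    intro l u v hl h hi hne x
    rcases le_total x₀ x with hx | hx
    · exact hz.ne_zero hB hl.le h hi hne hx
    · obtain ⟨y, hy⟩ := hne
      have := hz'.ne_zero hB.neg hl.le h.reflect hi.comp_neg ⟨-y, by simpa using hy⟩
        (neg_le_neg hx)
      simpa using this
  have n₁ := nodeless hl₁ h₁ hi₁ hne₁
  have n₂ := nodeless hl₂ h₂ hi₂ hne₂
  obtain ⟨a₁, b₁⟩ := h₁.tendsto_zero hB hW hl₁ hi₁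
  obtain ⟨a₂, b₂⟩ := h₂.tendsto_zero hB hW hl₂ hi₂
  obtain ⟨c₁, d₁⟩ := h₁.reflect.tendsto_zero hB.neg hW' hl₁ hi₁.comp_neg
  obtain ⟨c₂, d₂⟩ := h₂.reflect.tendsto_zero hB.neg hW' hl₂ hi₂.comp_neg
  have htop : Tendsto (fun x => u₁ x * v₂ x - u₂ x * v₁ x) atTop (𝓝 0) := by
    simpa using (a₁.mul b₂).sub (a₂.mul b₁)
  have hbot : Tendsto (fun x => u₁ (-x) * v₂ (-x) - u₂ (-x) * v₁ (-x)) atTop (𝓝 0) := by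
    simpa using (c₁.mul d₂.neg).sub (c₂.mul d₁.neg)
  have cu₁ := h₁.cont_u
  have cu₂ := h₂.cont_u
  have cp := hB.cont_p
  have hl : l₁ = l₂ := by
    by_contra hne
    have hne' : l₂ - l₁ ≠ 0 := sub_ne_zero.2 (Ne.symm hne)
    rcases forall_pos_or_forall_neg (f := fun x => p x * ((l₂ - l₁) * (u₁ x * u₂ x)))
      (by fun_prop) (fun x => mul_ne_zero (hB.p_pos x).ne'
        (mul_ne_zero hne' (mul_ne_zero (n₁ x) (n₂ x)))) with h | h
    · exact not_forall_hasDerivAt_pos (h₁.wronskian h₂) htop hbot h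
    · exact not_forall_hasDerivAt_pos (fun x => (h₁.wronskian h₂ x).neg)
        (by have := htop.neg; rwa [neg_zero] at this)
        (by have := hbot.neg; rwa [neg_zero] at this) fun x => neg_pos.2 (h x)
  subst hl
  refine ⟨rfl, u₁ x₀ / u₂ x₀, fun x => ?_⟩
  by_contra hx
  -- The combination chosen to vanish at x₀ is again square integrable, so the absence of zeros
  -- forces it to be identically zero.
  refine nodeless hl₁ (h₁.lin h₂ 1 (-(u₁ x₀ / u₂ x₀))) ?_ ⟨x, fun h0 => hx (by linarith)⟩ x₀ ?_
  · refine Integrable.mono' ((hi₁.const_mul 2).add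
      (hi₂.const_mul (2 * (u₁ x₀ / u₂ x₀) ^ 2)))
      (Continuous.aestronglyMeasurable (by fun_prop)) (Eventually.of_forall fun x => ?_)
    have hp := hB.p_pos x
    rw [Real.norm_of_nonneg (by positivity)]
    simp only [Pi.add_apply]
    have : (1 * u₁ x + -(u₁ x₀ / u₂ x₀) * u₂ x) ^ 2
        ≤ 2 * u₁ x ^ 2 + 2 * (u₁ x₀ / u₂ x₀) ^ 2 * u₂ x ^ 2 := by
      nlinarith [sq_nonneg (u₁ x + (u₁ x₀ / u₂ x₀) * u₂ x)]
    nlinarith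
  · have := n₂ x₀
    field_simp
    ring

end SturmSystem
-- The critical background in closed form and bounds on its potential.
noncomputable section

namespace ChargedWormhole

namespace Wormhole

open Filter Topology Set MeasureTheory SturmSystem

variable {κ₀ κ : ℝ} (w : Wormhole κ₀ κ)

/-- The profile `1 - γ₁ y` of a critical wormhole as a function of `x`. -/
def P (x : ℝ) : ℝ := 1 - w.γ₁ * w.y x

/-- The weight `e^{-2d}`. -/
def weight (x : ℝ) : ℝ := Real.exp (-2 * w.d x)

lemma r_pos (x : ℝ) : 0 < x ^ 2 + w.b ^ 2 := by
  have := w.b_pos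
  positivity

lemma hasDerivAt_r (x : ℝ) : HasDerivAt (fun x => x ^ 2 + w.b ^ 2) (2 * x) x := by
  simpa using (hasDerivAt_pow 2 x).add_const (w.b ^ 2)

lemma hasDerivAt_y (x : ℝ) : HasDerivAt w.y (w.b / (x ^ 2 + w.b ^ 2)) x := by
  have hb := w.b_pos
  have hr := w.r_pos x
  refine (((hasDerivAt_id x).div_const w.b).arctan).congr_deriv ?_
  simp only [id]
  field_simp
  ring

lemma hasDerivAt_P (x : ℝ) : HasDerivAt w.P (-(w.γ₁ * w.b) / (x ^ 2 + w.b ^ 2)) x :=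
  (((w.hasDerivAt_y x).const_mul w.γ₁).const_sub 1).congr_deriv (by ring)

lemma contDiff_y {n : WithTop ℕ∞} : ContDiff ℝ n w.y :=
  Real.contDiff_arctan.comp (contDiff_id.div_const _)

lemma contDiff_P {n : WithTop ℕ∞} : ContDiff ℝ n w.P :=
  contDiff_const.sub (contDiff_const.mul w.contDiff_y)

lemma weight_pos (x : ℝ) : 0 < w.weight x := Real.exp_pos _

lemma D_eq (f : ℝ → ℝ) (x : ℝ) : w.D f x = (w.weight x)⁻¹ * deriv f x := by
  rw [D, weight, ← Real.exp_neg]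
  ring_nf

lemma squareIntegrable_iff (f : ℝ → ℝ) :
    w.SquareIntegrable f ↔ Integrable fun x => w.weight x * f x ^ 2 := by
  simp only [SquareIntegrable, weight, mul_comm]

variable {w}

lemma IsCritical.profile_eq (hw : w.IsCritical) (y : ℝ) : profile w.Lsq w.γ₁ y = 1 - w.γ₁ * y := by
  rw [show w.Lsq = 0 from hw]
  simp [profile]

/-- P is affine in y with |y| < π/2. Positivity at both closed endpoints gives |γ₁| π/2 < 1, hence
the uniform bound m = 1 - |γ₁| π/2. -/
lemma IsCritical.exists_bounds (hw : w.IsCritical) : ∃ m, 0 < m ∧ ∀ x, m ≤ w.P x ∧ w.P x ≤ 2 := by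
  have hpi := Real.pi_pos
  have h1 := w.profile_pos (Real.pi / 2) ⟨by linarith, le_rfl⟩
  have h2 := w.profile_pos (-(Real.pi / 2)) ⟨le_rfl, by linarith⟩
  have e := hw.profile_eq
  rw [Lsq] at e
  rw [e] at h1 h2
  refine ⟨1 - |w.γ₁| * (Real.pi / 2), ?_, fun x => ?_⟩
  · rcases abs_cases w.γ₁ with h | h <;> rw [h.1] <;> linarith
  · have hy : |w.y x| ≤ Real.pi / 2 := (abs_lt.2 ⟨Real.neg_pi_div_two_lt_arctan _, Real.arctan_lt_pi_div_two _⟩).le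
    have h3 : |w.γ₁ * w.y x| ≤ |w.γ₁| * (Real.pi / 2) := by
      rw [abs_mul]
      gcongr
    have h4 : |w.γ₁| * (Real.pi / 2) < 1 := by
      rcases abs_cases w.γ₁ with h | h <;> rw [h.1] <;> linarith
    have h5 := abs_le.1 h3
    rw [P]
    constructor <;> linarith [h5.1, h5.2]

lemma IsCritical.P_pos (hw : w.IsCritical) (x : ℝ) : 0 < w.P x := by
  obtain ⟨m, hm, h⟩ := hw.exists_bounds
  exact hm.trans_le (h x).1

lemma IsCritical.d_eq (hw : w.IsCritical) (x : ℝ) : w.d x = w.γ₀ - Real.log (w.P x) := by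
  rw [d, hw.profile_eq, P]

lemma IsCritical.exp_d (hw : w.IsCritical) (x : ℝ) : Real.exp (w.d x) = Real.exp w.γ₀ / w.P x := by
  rw [hw.d_eq, Real.exp_sub, Real.exp_log (hw.P_pos x)]

lemma IsCritical.exp_c (hw : w.IsCritical) (x : ℝ) :
    Real.exp (w.c x) = √(x ^ 2 + w.b ^ 2) * w.P x / Real.exp w.γ₀ := by
  rw [c, Real.exp_sub, hw.exp_d, Real.exp_log (Real.sqrt_pos.2 (w.r_pos x)), div_div_eq_mul_div]

lemma IsCritical.weight_eq (hw : w.IsCritical) (x : ℝ) : w.weight x = w.P x ^ 2 / Real.exp w.γ₀ ^ 2 := by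
  have hP := hw.P_pos x
  rw [weight, show -2 * w.d x = -(w.d x + w.d x) by ring, Real.exp_neg, Real.exp_add, hw.exp_d]
  field_simp

lemma IsCritical.hasDerivAt_d (hw : w.IsCritical) (x : ℝ) :
    HasDerivAt w.d (w.γ₁ * w.b / ((x ^ 2 + w.b ^ 2) * w.P x)) x := by
  have hP := hw.P_pos x
  have hr := w.r_pos x
  have : w.d = fun x => w.γ₀ - Real.log (w.P x) := funext hw.d_eq
  rw [this]
  refine (((w.hasDerivAt_P x).log hP.ne').const_sub w.γ₀).congr_deriv ?_
  field_simp

lemma IsCritical.hasDerivAt_c (hw : w.IsCritical) (x : ℝ) :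
    HasDerivAt w.c (x / (x ^ 2 + w.b ^ 2) - w.γ₁ * w.b / ((x ^ 2 + w.b ^ 2) * w.P x)) x := by
  have hr := w.r_pos x
  have : w.c = fun x => Real.log (x ^ 2 + w.b ^ 2) / 2 - w.d x := by
    funext x
    rw [c, Real.log_sqrt (w.r_pos x).le]
  rw [this]
  refine ((((w.hasDerivAt_r x).log hr.ne').div_const 2).sub (hw.hasDerivAt_d x)).congr_deriv ?_
  ring

lemma IsCritical.contDiff_d (hw : w.IsCritical) {n : WithTop ℕ∞} : ContDiff ℝ n w.d := by
  have : w.d = fun x => w.γ₀ - Real.log (w.P x) := funext hw.d_eq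
  rw [this]
  exact contDiff_const.sub (w.contDiff_P.log fun x => (hw.P_pos x).ne')

lemma IsCritical.contDiff_c (hw : w.IsCritical) {n : WithTop ℕ∞} : ContDiff ℝ n w.c := by
  have : w.c = fun x => Real.log (x ^ 2 + w.b ^ 2) / 2 - w.d x := by
    funext x
    rw [c, Real.log_sqrt (w.r_pos x).le]
  rw [this]
  exact (((by fun_prop : ContDiff ℝ n fun x : ℝ => x ^ 2 + w.b ^ 2).log
    fun x => (w.r_pos x).ne').div_const 2).sub hw.contDiff_d

lemma IsCritical.dy_d (hw : w.IsCritical) (x : ℝ) : w.dy w.d x = w.γ₁ / w.P x := by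
  have hP := hw.P_pos x
  have hr := w.r_pos x
  have hb := w.b_pos
  rw [dy, (hw.hasDerivAt_d x).deriv]
  field_simp

lemma IsCritical.dy_c (hw : w.IsCritical) (x : ℝ) : w.dy w.c x = x / w.b - w.γ₁ / w.P x := by
  have hP := hw.P_pos x
  have hr := w.r_pos x
  have hb := w.b_pos
  rw [dy, (hw.hasDerivAt_c x).deriv]
  field_simp

/-- With Λ² = 0 one has F = 1 + (γ₁ / P) y, and γ₁ y = 1 - P. In particular F has no zeros and the
zero mode is regular. -/
lemma IsCritical.F_eq (hw : w.IsCritical) (x : ℝ) : w.F x = 1 / w.P x := by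
  have hP := hw.P_pos x
  rw [F, hw.dy_d, show w.Lsq = 0 from hw]
  have : w.γ₁ * w.y x = 1 - w.P x := by rw [P]; ring
  simp only [zero_mul, zero_add, add_zero, div_one]
  field_simp
  linarith

lemma IsCritical.G_eq (hw : w.IsCritical) (x : ℝ) : w.G x = 0 := by
  rw [G, show w.Lsq = 0 from hw]
  simp

lemma IsCritical.W_eq (hw : w.IsCritical) (x : ℝ) :
    w.W x = w.b ^ 2 * Real.exp w.γ₀ ^ 4 / ((x ^ 2 + w.b ^ 2) ^ 2 * w.P x ^ 4) *
      (-3 + 4 * (w.γ₁ / w.P x) ^ 2 - 2 * (w.γ₁ / w.P x) * (x / w.b)) := by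
  have hP := hw.P_pos x
  have hr := w.r_pos x
  have h4 : Real.exp (-4 * w.c x)
      = Real.exp w.γ₀ ^ 4 / ((x ^ 2 + w.b ^ 2) ^ 2 * w.P x ^ 4) := by
    have hs : √(x ^ 2 + w.b ^ 2) ^ 4 = (x ^ 2 + w.b ^ 2) ^ 2 := by
      rw [show 4 = 2 * 2 by norm_num, pow_mul, Real.sq_sqrt hr.le]
    rw [show -4 * w.c x = -((4 : ℕ) * w.c x) by push_cast; ring, Real.exp_neg, Real.exp_nat_mul,
      hw.exp_c, div_pow, mul_pow, hs, inv_div]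
  rw [W, hw.G_eq, hw.dy_d, hw.dy_c, h4, show w.Lsq = 0 from hw]
  ring

lemma IsCritical.contDiff_weight (hw : w.IsCritical) {n : WithTop ℕ∞} : ContDiff ℝ n w.weight :=
  Real.contDiff_exp.comp (contDiff_const.mul hw.contDiff_d)

lemma IsCritical.contDiff_W (hw : w.IsCritical) {n : WithTop ℕ∞} : ContDiff ℝ n w.W := by
  have hP : ContDiff ℝ n w.P := w.contDiff_P
  have hr : ContDiff ℝ n fun x : ℝ => x ^ 2 + w.b ^ 2 := by fun_prop
  have : w.W = _ := funext hw.W_eq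
  rw [this]
  have h1 : ∀ x, w.P x ≠ 0 := fun x => (hw.P_pos x).ne'
  have h2 : ∀ x : ℝ, (x ^ 2 + w.b ^ 2) ^ 2 * w.P x ^ 4 ≠ 0 := fun x =>
    mul_ne_zero (pow_ne_zero _ (w.r_pos x).ne') (pow_ne_zero _ (h1 x))
  have h3 : ContDiff ℝ n fun x => w.γ₁ / w.P x := contDiff_const.div hP h1
  exact (contDiff_const.div ((hr.pow 2).mul (hP.pow 4)) h2).mul
    ((contDiff_const.add (contDiff_const.mul (h3.pow 2))).sub
      ((contDiff_const.mul h3).mul (contDiff_id.div_const _)))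

/-- Since P is bounded below, the bracket grows at most linearly in x. One factor of x² + b² absorbs
it, leaving one of the two factors in the denominator. -/
lemma IsCritical.exists_W_le (hw : w.IsCritical) : ∃ C, 0 ≤ C ∧ ∀ x, |w.W x| ≤ C / (x ^ 2 + w.b ^ 2) := by
  obtain ⟨m, hm, hP⟩ := hw.exists_bounds
  have hb := w.b_pos
  refine ⟨w.b ^ 2 * Real.exp w.γ₀ ^ 4 / m ^ 4 *
    ((3 + 4 * (|w.γ₁| / m) ^ 2) / w.b ^ 2 + 2 * (|w.γ₁| / m) * (1 / w.b ^ 2)), by positivity,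
    fun x => ?_⟩
  have hr := w.r_pos x
  have hPx := hm.trans_le (hP x).1
  have hg : |w.γ₁ / w.P x| ≤ |w.γ₁| / m := by
    rw [abs_div, abs_of_pos hPx]
    gcongr
    exact (hP x).1
  have hA : |-3 + 4 * (w.γ₁ / w.P x) ^ 2 - 2 * (w.γ₁ / w.P x) * (x / w.b)|
      ≤ 3 + 4 * (|w.γ₁| / m) ^ 2 + 2 * (|w.γ₁| / m) * (|x| / w.b) := by
    refine (abs_sub _ _).trans (add_le_add ((abs_add_le _ _).trans (add_le_add ?_ ?_)) ?_)
    · norm_num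
    · rw [abs_of_nonneg (by positivity), ← sq_abs]
      gcongr
    · rw [abs_mul, abs_mul, abs_div x, abs_of_pos hb]
      norm_num
      gcongr
  have hxr : |x| / w.b ≤ (x ^ 2 + w.b ^ 2) / w.b ^ 2 := by
    rw [div_le_div_iff₀ hb (by positivity), ← sq_abs x]
    nlinarith [sq_nonneg (|x| - w.b), abs_nonneg x, mul_nonneg (abs_nonneg x) hb.le]
  have h1r : 1 ≤ (x ^ 2 + w.b ^ 2) / w.b ^ 2 := by
    rw [le_div_iff₀ (by positivity)]
    nlinarith [sq_nonneg x]
  rw [hw.W_eq, abs_mul, abs_of_pos (by positivity)]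
  calc _ ≤ w.b ^ 2 * Real.exp w.γ₀ ^ 4 / ((x ^ 2 + w.b ^ 2) ^ 2 * m ^ 4) *
        ((3 + 4 * (|w.γ₁| / m) ^ 2) * ((x ^ 2 + w.b ^ 2) / w.b ^ 2)
          + 2 * (|w.γ₁| / m) * ((x ^ 2 + w.b ^ 2) / w.b ^ 2)) := by
        refine mul_le_mul ?_ (hA.trans ?_) (abs_nonneg _) (by positivity)
        · gcongr
          exact (hP x).1
        · refine add_le_add (le_mul_of_one_le_right (by positivity) h1r) ?_
          gcongr
    _ = _ := by field_simp

lemma IsCritical.exists_W_bounds (hw : w.IsCritical) : ∃ M, (∀ x, |w.W x| ≤ M) ∧ Tendsto w.W atTop (𝓝 0) ∧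
    Tendsto (fun x => w.W (-x)) atTop (𝓝 0) := by
  obtain ⟨C, hC, h⟩ := hw.exists_W_le
  have hb := w.b_pos
  have ht : Tendsto (fun x : ℝ => C / (x ^ 2 + w.b ^ 2)) atTop (𝓝 0) :=
    tendsto_const_nhds.div_atTop
      (tendsto_atTop_add_const_right _ _ (tendsto_pow_atTop two_ne_zero))
  refine ⟨C / w.b ^ 2, fun x => (h x).trans ?_, squeeze_zero_norm h ht,
    squeeze_zero_norm (fun x => ?_) ht⟩
  · gcongr
    nlinarith [sq_nonneg x]
  · simpa using h (-x)

lemma IsCritical.exists_coefficient_bounds (hw : w.IsCritical) : ∃ p₁ p₂ M, Bounds w.weight w.W p₁ p₂ M := by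
  obtain ⟨m, hm, hP⟩ := hw.exists_bounds
  obtain ⟨M, hM, -⟩ := hw.exists_W_bounds
  refine ⟨m ^ 2 / Real.exp w.γ₀ ^ 2, 2 ^ 2 / Real.exp w.γ₀ ^ 2, M,
    (hw.contDiff_weight (n := 0)).continuous, (hw.contDiff_W (n := 0)).continuous,
    by positivity, fun x => ?_, fun x => ?_, hM⟩
  · rw [hw.weight_eq]
    gcongr
    exact (hP x).1
  · rw [hw.weight_eq]
    have := hw.P_pos x
    gcongr
    exact (hP x).2

/-- Bootstrap: the system has smooth coefficients, so each order of regularity of (u, v) yields the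
next. -/
lemma IsCritical.contDiff_of_isSol (hw : w.IsCritical) {l : ℝ} {u v : ℝ → ℝ} (h : IsSol w.weight w.W l u v) :
    ContDiff ℝ ((⊤ : ℕ∞) : WithTop ℕ∞) u ∧ ContDiff ℝ ((⊤ : ℕ∞) : WithTop ℕ∞) v := by
  have key : ∀ n : ℕ, ContDiff ℝ n u ∧ ContDiff ℝ n v := by
    intro n
    induction n with
    | zero => exact ⟨contDiff_zero.2 h.cont_u, contDiff_zero.2 h.cont_v⟩
    | succ n ih =>
      have hp : ContDiff ℝ n w.weight := hw.contDiff_weight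
      have hW : ContDiff ℝ n w.W := hw.contDiff_W
      have du : deriv u = fun x => w.weight x * v x := funext fun x => (h.du x).deriv
      have dv : deriv v = fun x => w.weight x * ((w.W x + l) * u x) :=
        funext fun x => (h.dv x).deriv
      push_cast
      refine ⟨contDiff_succ_iff_deriv.2 ⟨fun x => (h.du x).differentiableAt, by simp, ?_⟩,
        contDiff_succ_iff_deriv.2 ⟨fun x => (h.dv x).differentiableAt, by simp, ?_⟩⟩
      · rw [du]
        exact hp.mul ih.2
      · rw [dv]
        exact hp.mul ((hW.add contDiff_const).mul ih.1)
  exact ⟨contDiff_infty.2 fun n => (key n).1, contDiff_infty.2 fun n => (key n).2⟩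

/-- The second component v of the system is ∂u, and l is minus the energy. -/
lemma IsCritical.isStationary_of_isSol (hw : w.IsCritical) {l : ℝ} {u v : ℝ → ℝ} (h : IsSol w.weight w.W l u v) :
    w.IsStationary (-l) u := by
  refine ⟨by exact_mod_cast contDiff_infty.1 (hw.contDiff_of_isSol h).1 2, fun x => ?_⟩
  have hD : w.D u = v := by
    funext y
    rw [D_eq, (h.du y).deriv, inv_mul_cancel_left₀ (w.weight_pos y).ne']
  rw [hD, D_eq, (h.dv x).deriv, inv_mul_cancel_left₀ (w.weight_pos x).ne']
  ring

lemma IsCritical.isSol_of_isStationary (hw : w.IsCritical) {E : ℝ} {χ : ℝ → ℝ} (h : w.IsStationary E χ) :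
    IsSol w.weight w.W (-E) χ (w.D χ) := by
  have h1 : ContDiff ℝ 1 (deriv χ) :=
    ((contDiff_succ_iff_deriv (n := 1)).1 (by simpa [one_add_one_eq_two] using h.1)).2.2
  have h2 : Differentiable ℝ (w.D χ) := by
    have : w.D χ = fun x => (w.weight x)⁻¹ * deriv χ x := funext fun x => w.D_eq χ x
    rw [this]
    exact ((hw.contDiff_weight (n := 1)).inv fun x => (w.weight_pos x).ne').mul h1
      |>.differentiable one_ne_zero
  refine ⟨fun x => ?_, fun x => ?_⟩
  · rw [D_eq, mul_inv_cancel_left₀ (w.weight_pos x).ne']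
    exact ((h.1.differentiable two_ne_zero) x).hasDerivAt
  · refine (h2 x).hasDerivAt.congr_deriv ?_
    have h3 := h.2 x
    rw [w.D_eq (w.D χ)] at h3
    have := (w.weight_pos x).ne'
    field_simp at h3
    linarith

end Wormhole

end ChargedWormhole

end
-- The zero mode as a threshold resonance with one node.
noncomputable section

namespace ChargedWormhole

namespace Wormhole

open Filter Topology Set MeasureTheory SturmSystem

variable {κ₀ κ : ℝ} (w : Wormhole κ₀ κ)

lemma hasDerivAt_inv_sqrt (x : ℝ) : HasDerivAt (fun x => (√(x ^ 2 + w.b ^ 2))⁻¹)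
    (-x * (√(x ^ 2 + w.b ^ 2))⁻¹ / (x ^ 2 + w.b ^ 2)) x := by
  have hr := w.r_pos x
  have hs := Real.sqrt_pos.2 hr
  refine (((w.hasDerivAt_r x).sqrt hr.ne').inv hs.ne').congr_deriv ?_
  rw [Real.sq_sqrt hr.le]
  field_simp

/-- The function `(x P - γ₁ b) / √(x² + b²)`, which carries the sign of the zero mode. -/
def nodal (x : ℝ) : ℝ := (x * w.P x - w.γ₁ * w.b) * (√(x ^ 2 + w.b ^ 2))⁻¹

lemma hasDerivAt_nodal (x : ℝ) : HasDerivAt w.nodal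
    (w.P x * w.b ^ 2 / (x ^ 2 + w.b ^ 2) * (√(x ^ 2 + w.b ^ 2))⁻¹) x := by
  have hr := w.r_pos x
  refine ((((hasDerivAt_id x).mul (w.hasDerivAt_P x)).sub_const (w.γ₁ * w.b)).mul
    (w.hasDerivAt_inv_sqrt x)).congr_deriv ?_
  simp only [id, Pi.mul_apply]
  field_simp
  ring

/-- The derivative `∂χ₀` of the zero mode. -/
def zeroModeD (x : ℝ) : ℝ :=
  Real.exp w.γ₀ ^ 3 * (w.b * w.P x ^ 2 + w.γ₁ * x * w.P x - w.γ₁ ^ 2 * w.b) /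
    ((x ^ 2 + w.b ^ 2) * w.P x ^ 4) * (√(x ^ 2 + w.b ^ 2))⁻¹

variable {w}

lemma IsCritical.zeroMode_eq (hw : w.IsCritical) (x : ℝ) :
    w.zeroMode x = Real.exp w.γ₀ / w.b * (w.nodal x / w.P x) := by
  have hP := hw.P_pos x
  have hs := Real.sqrt_pos.2 (w.r_pos x)
  have hb := w.b_pos
  rw [zeroMode, hw.dy_c, hw.exp_c, hw.F_eq, nodal]
  field_simp

/-- In the derivative the terms with γ₁ cancel and P b² (x² + b²)^{-3/2} > 0 remains. This is why
the zero mode has only one node. -/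
lemma IsCritical.strictMono_nodal (hw : w.IsCritical) : StrictMono w.nodal :=
  strictMono_of_deriv_pos fun x => by
    have hP := hw.P_pos x
    have hr := w.r_pos x
    have hs := Real.sqrt_pos.2 hr
    have hb := w.b_pos
    rw [(w.hasDerivAt_nodal x).deriv]
    positivity

lemma IsCritical.isSol_zeroMode (hw : w.IsCritical) :
    IsSol w.weight w.W 0 w.zeroMode w.zeroModeD := by
  have hb := w.b_pos
  constructor <;> intro x
  · have hP := hw.P_pos x
    have hr := w.r_pos x
    have : w.zeroMode = fun x => Real.exp w.γ₀ / w.b * (w.nodal x / w.P x) :=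
      funext hw.zeroMode_eq
    rw [this]
    refine (((w.hasDerivAt_nodal x).div (w.hasDerivAt_P x) hP.ne').const_mul _).congr_deriv ?_
    rw [hw.weight_eq, zeroModeD, nodal]
    field_simp
    ring
  · have hP := hw.P_pos x
    have hr := w.r_pos x
    have hd := w.hasDerivAt_P x
    refine (((((((hd.pow 2).const_mul w.b).add
      (((hasDerivAt_id x).const_mul w.γ₁).mul hd)).sub_const (w.γ₁ ^ 2 * w.b)).const_mul
        (Real.exp w.γ₀ ^ 3)).div ((w.hasDerivAt_r x).mul (hd.pow 4)) (mul_ne_zero hr.ne' (pow_ne_zero 4 hP.ne'))).mul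
      (w.hasDerivAt_inv_sqrt x)).congr_deriv ?_
    rw [hw.weight_eq, hw.W_eq, hw.zeroMode_eq, nodal]
    simp only [id, Pi.mul_apply, Pi.add_apply, Pi.pow_apply, Pi.div_apply]
    field_simp
    ring

lemma IsCritical.exists_nodal_eq_zero (hw : w.IsCritical) : ∃ x₀, w.nodal x₀ = 0 := by
  obtain ⟨m, hm, hP⟩ := hw.exists_bounds
  have hc : Continuous w.nodal :=
    continuous_iff_continuousAt.2 fun x => (w.hasDerivAt_nodal x).continuousAt
  have hb := w.b_pos
  -- Chosen so that X m = |γ₁| b; as P ≥ m, the term x P dominates γ₁ b at x = ±X.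
  set X := |w.γ₁| * w.b / m with hX
  have hX0 : 0 ≤ X := by positivity
  have hXm : X * m = |w.γ₁| * w.b := by rw [hX]; field_simp
  have h1 := (abs_le.1 (le_refl |w.γ₁|)).1
  have h2 := le_abs_self w.γ₁
  refine mem_range_of_exists_le_of_exists_ge hc ⟨-X, ?_⟩ ⟨X, ?_⟩
  · have := (hP (-X)).1
    refine mul_nonpos_of_nonpos_of_nonneg ?_ (by positivity)
    nlinarith
  · have := (hP X).1
    refine mul_nonneg ?_ (by positivity)
    nlinarith

lemma IsCritical.exists_abs_zeroMode_le (hw : w.IsCritical) : ∃ Z, ∀ x, |w.zeroMode x| ≤ Z := by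
  obtain ⟨m, hm, hP⟩ := hw.exists_bounds
  have hb := w.b_pos
  refine ⟨Real.exp w.γ₀ / w.b * ((2 + |w.γ₁|) / m), fun x => ?_⟩
  have hr := w.r_pos x
  have hPx := hw.P_pos x
  have hs := Real.sqrt_pos.2 hr
  have hxs : |x| ≤ √(x ^ 2 + w.b ^ 2) := Real.abs_le_sqrt (by nlinarith)
  have hbs : w.b ≤ √(x ^ 2 + w.b ^ 2) := Real.le_sqrt_of_sq_le (by nlinarith)
  have hn : |w.nodal x| ≤ 2 + |w.γ₁| := by
    rw [nodal, abs_mul, abs_inv, abs_of_pos hs, mul_inv_le_iff₀ hs]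
    refine (abs_sub _ _).trans ?_
    rw [abs_mul, abs_mul, abs_of_pos hPx, abs_of_pos hb, add_mul]
    refine add_le_add ?_ (by gcongr)
    rw [mul_comm]
    have := (hP x).2
    gcongr
  rw [hw.zeroMode_eq, abs_mul, abs_div (w.nodal x), abs_of_pos hPx,
    abs_of_pos (by positivity : 0 < Real.exp w.γ₀ / w.b)]
  have := (hP x).1
  gcongr

/-- The zero mode is a positive constant times `nodal` / P. Monotonicity of `nodal` gives its sign
on each side of x₀, and with P ≤ 2 a positive lower bound beyond x₀ ± 1. The left half-line is
reflected onto the right one, with the sign of the mode reversed. -/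
lemma IsCritical.exists_threshold (hw : w.IsCritical) : ∃ x₀,
    IsThreshold w.weight w.W x₀ w.zeroMode w.zeroModeD ∧
    IsThreshold (fun x => w.weight (-x)) (fun x => w.W (-x)) (-x₀)
      (fun x => -w.zeroMode (-x)) (fun x => - -w.zeroModeD (-x)) := by
  obtain ⟨x₀, h0⟩ := hw.exists_nodal_eq_zero
  obtain ⟨m, hm, hP⟩ := hw.exists_bounds
  have hb := w.b_pos
  have hmono := hw.strictMono_nodal
  have hz0 : w.zeroMode x₀ = 0 := by rw [hw.zeroMode_eq, h0]; simp
  have hpos : ∀ x, x₀ < x → 0 < w.zeroMode x := fun x hx => by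
    have h1 : 0 < w.nodal x := h0 ▸ hmono hx
    have := hw.P_pos x
    rw [hw.zeroMode_eq]
    positivity
  have hneg : ∀ x, x < x₀ → 0 < -w.zeroMode x := fun x hx => by
    have h1 : 0 < -w.nodal x := by linarith [h0 ▸ hmono hx]
    have := hw.P_pos x
    rw [hw.zeroMode_eq, ← mul_neg, ← neg_div]
    positivity
  have hd : 0 < w.zeroModeD x₀ := by
    have hr := w.r_pos x₀
    have hs := Real.sqrt_pos.2 hr
    have hPx := hw.P_pos x₀
    have h1 : x₀ * w.P x₀ - w.γ₁ * w.b = 0 :=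
      (mul_eq_zero.1 h0).resolve_right (inv_pos.2 hs).ne'
    -- At the node x₀ P = γ₁ b, which reduces the numerator of `zeroModeD` to b P².
    have h2 : w.b * w.P x₀ ^ 2 + w.γ₁ * x₀ * w.P x₀ - w.γ₁ ^ 2 * w.b = w.b * w.P x₀ ^ 2 := by
      linear_combination w.γ₁ * h1
    rw [zeroModeD, h2]
    positivity
  obtain ⟨Z, hZ⟩ := hw.exists_abs_zeroMode_le
  refine ⟨x₀, ⟨hw.isSol_zeroMode, hz0, hd, hpos, ⟨Z, hZ⟩,
    Real.exp w.γ₀ / w.b * (w.nodal (x₀ + 1) / 2), ?_, ?_⟩,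
    ⟨hw.isSol_zeroMode.reflect.neg, by simp [hz0], by simpa using hd,
    fun x hx => hneg _ (by linarith), ⟨Z, fun x => by simpa using hZ (-x)⟩,
    Real.exp w.γ₀ / w.b * (-w.nodal (x₀ - 1) / 2), ?_, ?_⟩⟩
  · have h1 : 0 < w.nodal (x₀ + 1) := h0 ▸ hmono (lt_add_one x₀)
    positivity
  · filter_upwards [eventually_ge_atTop (x₀ + 1)] with x hx
    have h1 : 0 < w.nodal (x₀ + 1) := h0 ▸ hmono (lt_add_one x₀)
    have h2 := hmono.monotone hx
    have h3 := hw.P_pos x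
    have h4 := (hP x).2
    have h5 := h1.le.trans h2
    rw [hw.zeroMode_eq]
    gcongr
  · have h1 : 0 < -w.nodal (x₀ - 1) := by linarith [h0 ▸ hmono (sub_one_lt x₀)]
    positivity
  · filter_upwards [eventually_ge_atTop (-x₀ + 1)] with x hx
    have h1 : 0 < -w.nodal (x₀ - 1) := by linarith [h0 ▸ hmono (sub_one_lt x₀)]
    have h2 := neg_le_neg (hmono.monotone (by linarith : -x ≤ x₀ - 1))
    have h3 := hw.P_pos (-x)
    have h4 := (hP (-x)).2
    have h5 := h1.le.trans h2
    rw [hw.zeroMode_eq, ← mul_neg, ← neg_div]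
    gcongr

/-- The zero mode is a threshold resonance: it solves the equation but is not square integrable. -/
theorem IsCritical.zeroMode_isStationary (hw : w.IsCritical) : w.IsStationary 0 w.zeroMode := by
  simpa using hw.isStationary_of_isSol hw.isSol_zeroMode

theorem IsCritical.zeroMode_not_squareIntegrable (hw : w.IsCritical) :
    ¬ w.SquareIntegrable w.zeroMode := by
  obtain ⟨x₀, hz, -⟩ := hw.exists_threshold
  obtain ⟨p₁, p₂, M, hB⟩ := hw.exists_coefficient_bounds
  obtain ⟨c, hc, hcz⟩ := hz.away
  rw [squareIntegrable_iff]
  intro hi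
  refine not_integrableOn_of_le_sq hB (a := 0) (pow_pos hc 2) ?_ hi.integrableOn
  filter_upwards [hcz] with x hx
  gcongr

/-- There is exactly one bound state of negative energy. -/
theorem IsCritical.exists_unique_bound_state (hw : w.IsCritical) :
    ∃ β : ℝ, 0 < β ∧ ∃ u v : ℝ → ℝ, IsSol w.weight w.W (β ^ 2) u v ∧
      w.IsBoundState (-β ^ 2) u ∧ w.SquareIntegrable v ∧
      ∀ (E : ℝ) (χ : ℝ → ℝ), E < 0 → w.IsBoundState E χ →
        E = -β ^ 2 ∧ ∃ k : ℝ, ∀ x, χ x = k * u x := by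
  obtain ⟨x₀, hz, hz'⟩ := hw.exists_threshold
  obtain ⟨p₁, p₂, M, hB⟩ := hw.exists_coefficient_bounds
  obtain ⟨-, -, hW, hW'⟩ := hw.exists_W_bounds
  obtain ⟨l, hl, u, v, h, hu, hv, hne⟩ := exists_bound_state hB hW hW' hz hz'
  have hs : √l ^ 2 = l := Real.sq_sqrt hl.le
  refine ⟨√l, Real.sqrt_pos.2 hl, u, v, by rwa [hs], ?_, (w.squareIntegrable_iff v).2 hv,
    fun E χ hE hχ => ?_⟩
  · rw [hs]
    exact ⟨hw.isStationary_of_isSol h, (w.squareIntegrable_iff u).2 hu, hne⟩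
  · obtain ⟨h1, h2⟩ := bound_state_unique hB hW hW' hz hz' (neg_pos.2 hE) hl
      (hw.isSol_of_isStationary hχ.1) h ((w.squareIntegrable_iff χ).1 hχ.2.1) hu hχ.2.2 hne
    refine ⟨by rw [hs]; linarith, h2⟩

end Wormhole

end ChargedWormhole

end
-- Reduction of the linearized field equations to radial equations.
noncomputable section

namespace ChargedWormhole

lemma pt_eq_of_hasDerivAt {f : ℝ → ℝ → ℝ} {t x f' : ℝ} (h : HasDerivAt (fun s => f s x) f' t) :
    pt f t x = f' := h.deriv

lemma px_eq_of_hasDerivAt {f : ℝ → ℝ → ℝ} {t x f' : ℝ} (h : HasDerivAt (f t) f' x) :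
    px f t x = f' := h.deriv

/-- Along S + s δ every field and every derivative of a field is affine in s, so the linearization
needs only the derivatives of affine functions and of their exponentials. -/
lemma hasDerivAt_affine (A B : ℝ) : HasDerivAt (fun s : ℝ => A + s * B) B 0 := by
  simpa using ((hasDerivAt_id (0 : ℝ)).mul_const B).const_add A

lemma hasDerivAt_exp_affine (A B : ℝ) :
    HasDerivAt (fun s : ℝ => Real.exp (A + s * B)) (Real.exp A * B) 0 := by
  simpa using (hasDerivAt_affine A B).exp

/-- The static fields with radial functions `d`, `a = -d`, `c`, `φ`. -/
def staticFields (d c φ : ℝ → ℝ) : Fields where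
  d := fun _ x => d x
  a := fun _ x => -d x
  c := fun _ x => c x
  Φ := fun _ x => φ x

/-- The perturbation `e^{βt} (δ, α, C, 0)`. -/
def modeFields (β : ℝ) (δ α C : ℝ → ℝ) : Fields where
  d := fun t x => Real.exp (β * t) * δ x
  a := fun t x => Real.exp (β * t) * α x
  c := fun t x => Real.exp (β * t) * C x
  Φ := fun _ _ => 0

section

variable {β s : ℝ} {d d₁ d₂ c c₁ c₂ φ φ₁ φ₂ δ δ₁ δ₂ α α₁ C C₁ C₂ : ℝ → ℝ}

lemma hasDerivAt_exp_mul (β : ℝ) (t : ℝ) :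
    HasDerivAt (fun t => Real.exp (β * t)) (β * Real.exp (β * t)) t := by
  have : HasDerivAt (fun t => β * t) β t := by simpa using (hasDerivAt_id t).const_mul β
  exact this.exp.congr_deriv (by ring)

lemma hasDerivAt_time (A s B t : ℝ) : HasDerivAt (fun t => A + s * (Real.exp (β * t) * B))
    (s * (β * Real.exp (β * t) * B)) t :=
  (((hasDerivAt_exp_mul β t).mul_const B).const_mul s).const_add A

lemma hasDerivAt_space {f f₁ g g₁ : ℝ → ℝ} (hf : ∀ x, HasDerivAt f (f₁ x) x)
    (hg : ∀ x, HasDerivAt g (g₁ x) x) (s m x : ℝ) :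
    HasDerivAt (fun x => f x + s * (m * g x)) (f₁ x + s * (m * g₁ x)) x :=
  (hf x).add (((hg x).const_mul m).const_mul s)

/-- The linearized field equations for a mode with vanishing scalar perturbation, as equations for
the radial functions. -/
theorem solvesLinearizedEquations_of_radial {κ₀ κ Qsq : ℝ}
    (hd : ∀ x, HasDerivAt d (d₁ x) x) (hd₁ : ∀ x, HasDerivAt d₁ (d₂ x) x)
    (hc : ∀ x, HasDerivAt c (c₁ x) x) (hc₁ : ∀ x, HasDerivAt c₁ (c₂ x) x)
    (hφ : ∀ x, HasDerivAt φ (φ₁ x) x) (hφ₁ : ∀ x, HasDerivAt φ₁ (φ₂ x) x)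
    (hδ : ∀ x, HasDerivAt δ (δ₁ x) x) (hδ₁ : ∀ x, HasDerivAt δ₁ (δ₂ x) x)
    (hα : ∀ x, HasDerivAt α (α₁ x) x)
    (hC : ∀ x, HasDerivAt C (C₁ x) x) (hC₁ : ∀ x, HasDerivAt C₁ (C₂ x) x)
    (e₁ : ∀ x, Real.exp (-2 * d x) * (β ^ 2 * α x)
      - Real.exp (2 * d x) * ((δ x - α x) * (2 * d₁ x ^ 2 + d₂ x)
        + (δ₁ x - α₁ x) * d₁ x + 2 * d₁ x * δ₁ x + δ₂ x)
      + Real.exp (2 * d x) * ((δ x - α x) * c₁ x ^ 2 + 2 * c₁ x * C₁ x)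
      - Real.exp (-2 * c x) * (α x + δ x - 2 * C x)
      + κ₀ * Qsq * Real.exp (-4 * c x) * (α x + δ x - 4 * C x)
      - κ / 2 * Real.exp (2 * d x) * (δ x - α x) * φ₁ x ^ 2 = 0)
    (e₂ : ∀ x, Real.exp (-2 * d x + 2 * c x) * (β ^ 2 * C x)
      - Real.exp (2 * d x + 2 * c x) * ((δ x - α x + 2 * C x) * ((2 * d₁ x + 2 * c₁ x) * c₁ x + c₂ x)
        + (δ₁ x - α₁ x + 2 * C₁ x) * c₁ x + (2 * d₁ x + 2 * c₁ x) * C₁ x + C₂ x)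
      + (α x + δ x) - κ₀ / 2 * Qsq * Real.exp (-2 * c x) * (α x + δ x - 2 * C x) = 0)
    (e₃ : ∀ x, (δ x - α x + 2 * C x) * ((2 * d₁ x + 2 * c₁ x) * φ₁ x + φ₂ x)
      + (δ₁ x - α₁ x + 2 * C₁ x) * φ₁ x = 0)
    (e₄ : ∀ x, Real.exp (2 * d x) * ((δ x - α x) * (2 * c₂ x + (3 * c₁ x + 2 * d₁ x) * c₁ x)
        + (2 * C₂ x + (3 * C₁ x - 2 * α₁ x) * c₁ x + (3 * c₁ x + 2 * d₁ x) * C₁ x))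
      - Real.exp (-2 * c x) * (α x + δ x - 2 * C x)
      + κ₀ / 2 * Qsq * Real.exp (-4 * c x) * (α x + δ x - 4 * C x)
      + κ / 2 * Real.exp (2 * d x) * (δ x - α x) * φ₁ x ^ 2 = 0)
    (e₅ : ∀ x, C₁ x + c₁ x * C x - d₁ x * C x - c₁ x * α x = 0) :
    SolvesLinearizedEquations κ₀ κ Qsq (staticFields d c φ) (modeFields β δ α C) := by
  intro t x
  set T : ℝ → Fields := fun s => (staticFields d c φ).perturb (modeFields β δ α C) s with hT
  have Ta : ∀ s, (T s).a = fun t x => -d x + s * (Real.exp (β * t) * α x) := fun s => rfl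
  have Td : ∀ s, (T s).d = fun t x => d x + s * (Real.exp (β * t) * δ x) := fun s => rfl
  have Tc : ∀ s, (T s).c = fun t x => c x + s * (Real.exp (β * t) * C x) := fun s => rfl
  have Tφ : ∀ s, (T s).Φ = fun _ x => φ x := fun s => by
    funext t x
    simp [hT, Fields.perturb, staticFields, modeFields]
  have ta : ∀ s, pt (T s).a = fun t x => s * (β * Real.exp (β * t) * α x) := fun s => by
    funext t x
    exact pt_eq_of_hasDerivAt (hasDerivAt_time _ _ _ _)
  have tc : ∀ s, pt (T s).c = fun t x => s * (β * Real.exp (β * t) * C x) := fun s => by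
    funext t x
    exact pt_eq_of_hasDerivAt (hasDerivAt_time _ _ _ _)
  have tφ : ∀ s, pt (T s).Φ = fun _ _ => 0 := fun s => by
    funext t x
    rw [Tφ]
    exact pt_eq_of_hasDerivAt (hasDerivAt_const _ _)
  have hnd : ∀ x, HasDerivAt (fun x => -d x) (-d₁ x) x := fun x => (hd x).neg
  have xa : ∀ s, px (T s).a = fun t x => -d₁ x + s * (Real.exp (β * t) * α₁ x) := fun s => by
    funext t x
    exact px_eq_of_hasDerivAt (hasDerivAt_space hnd hα _ _ _)
  have xd : ∀ s, px (T s).d = fun t x => d₁ x + s * (Real.exp (β * t) * δ₁ x) := fun s => by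
    funext t x
    exact px_eq_of_hasDerivAt (hasDerivAt_space hd hδ _ _ _)
  have xc : ∀ s, px (T s).c = fun t x => c₁ x + s * (Real.exp (β * t) * C₁ x) := fun s => by
    funext t x
    exact px_eq_of_hasDerivAt (hasDerivAt_space hc hC _ _ _)
  have xφ : ∀ s, px (T s).Φ = fun _ x => φ₁ x := fun s => by
    funext t x
    rw [Tφ]
    exact px_eq_of_hasDerivAt (hφ x)
  have xxc : ∀ s, px (px (T s).c) = fun t x => c₂ x + s * (Real.exp (β * t) * C₂ x) := fun s => by
    funext t x
    rw [xc]
    exact px_eq_of_hasDerivAt (hasDerivAt_space hc₁ hC₁ _ _ _)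
  have txc : ∀ s, pt (px (T s).c) = fun t x => s * (β * Real.exp (β * t) * C₁ x) := fun s => by
    funext t x
    rw [xc]
    exact pt_eq_of_hasDerivAt (hasDerivAt_time _ _ _ _)
  have htt : ∀ s A B t, HasDerivAt (fun t => Real.exp (A + s * (Real.exp (β * t) * B)))
      (Real.exp (A + s * (Real.exp (β * t) * B)) * (s * (β * Real.exp (β * t) * B))) t :=
    fun s A B t => (hasDerivAt_time _ _ _ _).exp
  have ht2 : ∀ s B t, HasDerivAt (fun t => s * (β * Real.exp (β * t) * B))
      (s * (β * (β * Real.exp (β * t)) * B)) t := fun s B t =>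
    (((hasDerivAt_exp_mul β t).const_mul β).mul_const B).const_mul s
  set m := Real.exp (β * t) with hm
  refine ⟨?_, ?_, ?_, ?_, ?_⟩
  -- The equation is put in the form of products of affine functions of s and exponentials of such.
  -- Terms without background value are written `0 + s * _` so that `hasDerivAt_affine` applies to
  -- them too.
  · have H : (fun s => evolution₁ κ₀ κ Qsq (T s) t x) = fun s =>
        Real.exp (-2 * d x + s * (m * (α x - δ x))) *
          ((0 + s * (m * (α x - δ x) * β)) * (0 + s * (m * β * α x)) + (0 + s * (m * β ^ 2 * α x)))
        - Real.exp (2 * d x + s * (m * (δ x - α x))) *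
          ((2 * d₁ x + s * (m * (δ₁ x - α₁ x))) * (d₁ x + s * (m * δ₁ x)) + (d₂ x + s * (m * δ₂ x)))
        - Real.exp (-2 * d x + s * (m * (α x - δ x))) * (0 + s * (β * m * C x)) ^ 2
        + Real.exp (2 * d x + s * (m * (δ x - α x))) * (c₁ x + s * (m * C₁ x)) ^ 2
        - Real.exp (-2 * c x + s * (m * (α x + δ x - 2 * C x)))
        + κ₀ * Qsq * Real.exp (-4 * c x + s * (m * (α x + δ x - 4 * C x)))
        - κ / 2 * Real.exp (2 * d x + s * (m * (δ x - α x))) * φ₁ x ^ 2 := by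
      funext s
      have h1 : pt (fun t x => Real.exp ((T s).a t x - (T s).d t x) * pt (T s).a t x) t x
          = Real.exp (-2 * d x + s * (m * (α x - δ x))) *
          ((0 + s * (m * (α x - δ x) * β)) * (0 + s * (m * β * α x))
            + (0 + s * (m * β ^ 2 * α x))) := by
        rw [ta]
        have : (fun t x => Real.exp ((T s).a t x - (T s).d t x) * (s * (β * Real.exp (β * t) * α x)))
            = fun t x => Real.exp (-2 * d x + s * (Real.exp (β * t) * (α x - δ x)))
              * (s * (β * Real.exp (β * t) * α x)) := by
          funext t x
          rw [Ta, Td]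
          ring_nf
        rw [this]
        refine pt_eq_of_hasDerivAt (((htt _ _ _ _).mul (ht2 _ _ _)).congr_deriv ?_)
        rw [← hm]
        ring
      have h2 : px (fun t x => Real.exp ((T s).d t x - (T s).a t x) * px (T s).d t x) t x
          = Real.exp (2 * d x + s * (m * (δ x - α x))) *
          ((2 * d₁ x + s * (m * (δ₁ x - α₁ x))) * (d₁ x + s * (m * δ₁ x))
            + (d₂ x + s * (m * δ₂ x))) := by
        rw [xd]
        have : (fun t x => Real.exp ((T s).d t x - (T s).a t x)
              * (d₁ x + s * (Real.exp (β * t) * δ₁ x)))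
            = fun t x => Real.exp (2 * d x + s * (Real.exp (β * t) * (δ x - α x)))
              * (d₁ x + s * (Real.exp (β * t) * δ₁ x)) := by
          funext t x
          rw [Ta, Td]
          ring_nf
        rw [this]
        refine px_eq_of_hasDerivAt (((hasDerivAt_space (fun x => (hd x).const_mul 2)
          (fun x => (hδ x).sub (hα x)) s _ x).exp.mul
            (hasDerivAt_space hd₁ hδ₁ s _ x)).congr_deriv ?_)
        simp only [Pi.sub_apply, ← hm]
        ring
      rw [evolution₁, h1, h2, tc, xc, tφ, xφ, Ta, Td, Tc]
      simp only [← hm]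
      rw [show -d x + s * (m * α x) - (d x + s * (m * δ x))
          = -2 * d x + s * (m * (α x - δ x)) by ring,
        show d x + s * (m * δ x) - (-d x + s * (m * α x))
          = 2 * d x + s * (m * (δ x - α x)) by ring,
        show -d x + s * (m * α x) + (d x + s * (m * δ x)) - 2 * (c x + s * (m * C x))
          = -2 * c x + s * (m * (α x + δ x - 2 * C x)) by ring,
        show -d x + s * (m * α x) + (d x + s * (m * δ x)) - 4 * (c x + s * (m * C x))
          = -4 * c x + s * (m * (α x + δ x - 4 * C x)) by ring]
      ring
    rw [H]
    refine HasDerivAt.congr_deriv ((((((((hasDerivAt_exp_affine _ _).mul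
      (((hasDerivAt_affine _ _).mul (hasDerivAt_affine _ _)).add (hasDerivAt_affine _ _))).sub
      ((hasDerivAt_exp_affine _ _).mul
      (((hasDerivAt_affine _ _).mul (hasDerivAt_affine _ _)).add (hasDerivAt_affine _ _)))).sub
      ((hasDerivAt_exp_affine _ _).mul ((hasDerivAt_affine _ _).pow 2))).add
      ((hasDerivAt_exp_affine _ _).mul ((hasDerivAt_affine _ _).pow 2))).sub
      (hasDerivAt_exp_affine _ _)).add ((hasDerivAt_exp_affine _ _).const_mul (κ₀ * Qsq))).sub
      (((hasDerivAt_exp_affine _ _).const_mul (κ / 2)).mul_const (φ₁ x ^ 2))) ?_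
    simp only [Pi.mul_apply, Pi.add_apply, Pi.pow_apply, zero_mul, add_zero]
    -- All time dependence of the linearization is the common factor m = e^{βt}; terms quadratic in
    -- the perturbation have dropped out at s = 0.
    linear_combination m * e₁ x
  · have H : (fun s => evolution₂ κ₀ Qsq (T s) t x) = fun s =>
        Real.exp (-2 * d x + 2 * c x + s * (m * (α x - δ x + 2 * C x))) *
          ((0 + s * (m * (α x - δ x + 2 * C x) * β)) * (0 + s * (m * β * C x))
            + (0 + s * (m * β ^ 2 * C x)))
        - Real.exp (2 * d x + 2 * c x + s * (m * (δ x - α x + 2 * C x))) *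
          ((2 * d₁ x + 2 * c₁ x + s * (m * (δ₁ x - α₁ x + 2 * C₁ x))) * (c₁ x + s * (m * C₁ x))
            + (c₂ x + s * (m * C₂ x)))
        + Real.exp (0 + s * (m * (α x + δ x)))
        - κ₀ / 2 * Qsq * Real.exp (-2 * c x + s * (m * (α x + δ x - 2 * C x))) := by
      funext s
      have h1 : pt (fun t x => Real.exp ((T s).a t x - (T s).d t x + 2 * (T s).c t x)
            * pt (T s).c t x) t x
          = Real.exp (-2 * d x + 2 * c x + s * (m * (α x - δ x + 2 * C x))) *
          ((0 + s * (m * (α x - δ x + 2 * C x) * β)) * (0 + s * (m * β * C x))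
            + (0 + s * (m * β ^ 2 * C x))) := by
        rw [tc]
        have : (fun t x => Real.exp ((T s).a t x - (T s).d t x + 2 * (T s).c t x)
              * (s * (β * Real.exp (β * t) * C x)))
            = fun t x => Real.exp (-2 * d x + 2 * c x
                + s * (Real.exp (β * t) * (α x - δ x + 2 * C x)))
              * (s * (β * Real.exp (β * t) * C x)) := by
          funext t x
          rw [Ta, Td, Tc]
          ring_nf
        rw [this]
        refine pt_eq_of_hasDerivAt (((htt _ _ _ _).mul (ht2 _ _ _)).congr_deriv ?_)
        rw [← hm]
        ring
      have h2 : px (fun t x => Real.exp ((T s).d t x - (T s).a t x + 2 * (T s).c t x)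
            * px (T s).c t x) t x
          = Real.exp (2 * d x + 2 * c x + s * (m * (δ x - α x + 2 * C x))) *
          ((2 * d₁ x + 2 * c₁ x + s * (m * (δ₁ x - α₁ x + 2 * C₁ x))) * (c₁ x + s * (m * C₁ x))
            + (c₂ x + s * (m * C₂ x))) := by
        rw [xc]
        have : (fun t x => Real.exp ((T s).d t x - (T s).a t x + 2 * (T s).c t x)
              * (c₁ x + s * (Real.exp (β * t) * C₁ x)))
            = fun t x => Real.exp (2 * d x + 2 * c x
                + s * (Real.exp (β * t) * (δ x - α x + 2 * C x)))
              * (c₁ x + s * (Real.exp (β * t) * C₁ x)) := by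
          funext t x
          rw [Ta, Td, Tc]
          ring_nf
        rw [this]
        refine px_eq_of_hasDerivAt (((hasDerivAt_space
          (fun x => ((hd x).const_mul 2).add ((hc x).const_mul 2))
          (fun x => ((hδ x).sub (hα x)).add ((hC x).const_mul 2)) s _ x).exp.mul
            (hasDerivAt_space hc₁ hC₁ s _ x)).congr_deriv ?_)
        simp only [Pi.sub_apply, Pi.add_apply, ← hm]
        ring
      rw [evolution₂, h1, h2, Ta, Td, Tc]
      simp only [← hm]
      rw [show -d x + s * (m * α x) + (d x + s * (m * δ x))
          = 0 + s * (m * (α x + δ x)) by ring,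
        show 0 + s * (m * (α x + δ x)) - 2 * (c x + s * (m * C x))
          = -2 * c x + s * (m * (α x + δ x - 2 * C x)) by ring]
      ring
    rw [H]
    refine HasDerivAt.congr_deriv (((((hasDerivAt_exp_affine _ _).mul
      (((hasDerivAt_affine _ _).mul (hasDerivAt_affine _ _)).add (hasDerivAt_affine _ _))).sub
      ((hasDerivAt_exp_affine _ _).mul
      (((hasDerivAt_affine _ _).mul (hasDerivAt_affine _ _)).add (hasDerivAt_affine _ _)))).add
      (hasDerivAt_exp_affine _ _)).sub ((hasDerivAt_exp_affine _ _).const_mul (κ₀ / 2 * Qsq))) ?_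
    simp only [Pi.mul_apply, Pi.add_apply, zero_mul, add_zero, Real.exp_zero]
    linear_combination m * e₂ x
  · have H : (fun s => evolution₃ (T s) t x) = fun s =>
        -(Real.exp (2 * d x + 2 * c x + s * (m * (δ x - α x + 2 * C x))) *
          ((2 * d₁ x + 2 * c₁ x + s * (m * (δ₁ x - α₁ x + 2 * C₁ x))) * φ₁ x + φ₂ x)) := by
      funext s
      have h1 : pt (fun t x => Real.exp ((T s).a t x - (T s).d t x + 2 * (T s).c t x)
            * pt (T s).Φ t x) t x = 0 := by
        rw [tφ]
        simp only [mul_zero]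
        exact pt_eq_of_hasDerivAt (hasDerivAt_const _ _)
      have h2 : px (fun t x => Real.exp ((T s).d t x - (T s).a t x + 2 * (T s).c t x)
            * px (T s).Φ t x) t x
          = Real.exp (2 * d x + 2 * c x + s * (m * (δ x - α x + 2 * C x))) *
          ((2 * d₁ x + 2 * c₁ x + s * (m * (δ₁ x - α₁ x + 2 * C₁ x))) * φ₁ x + φ₂ x) := by
        rw [xφ]
        have : (fun t x => Real.exp ((T s).d t x - (T s).a t x + 2 * (T s).c t x) * φ₁ x)
            = fun t x => Real.exp (2 * d x + 2 * c x
                + s * (Real.exp (β * t) * (δ x - α x + 2 * C x))) * φ₁ x := by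
          funext t x
          rw [Ta, Td, Tc]
          ring_nf
        rw [this]
        refine px_eq_of_hasDerivAt (((hasDerivAt_space
          (fun x => ((hd x).const_mul 2).add ((hc x).const_mul 2))
          (fun x => ((hδ x).sub (hα x)).add ((hC x).const_mul 2)) s _ x).exp.mul
            (hφ₁ x)).congr_deriv ?_)
        simp only [Pi.sub_apply, Pi.add_apply, ← hm]
        ring
      rw [evolution₃, h1, h2]
      ring
    rw [H]
    refine HasDerivAt.congr_deriv ((hasDerivAt_exp_affine _ _).mul
      (((hasDerivAt_affine _ _).mul_const (φ₁ x)).add_const (φ₂ x))).neg ?_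
    simp only [zero_mul, add_zero]
    linear_combination (-m * Real.exp (2 * d x + 2 * c x)) * e₃ x
  · have H : (fun s => hamiltonian κ₀ κ Qsq (T s) t x) = fun s =>
        Real.exp (2 * d x + s * (m * (δ x - α x))) *
          ((2 * c₂ x + s * (2 * (m * C₂ x)))
            + (3 * c₁ x + 2 * d₁ x + s * (m * (3 * C₁ x - 2 * α₁ x))) * (c₁ x + s * (m * C₁ x)))
        - Real.exp (-2 * d x + s * (m * (α x - δ x))) * ((0 + s * (β * m * C x))
            * (0 + s * (β * m * (2 * α x + C x))))
        - Real.exp (-2 * c x + s * (m * (α x + δ x - 2 * C x)))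
        + κ₀ / 2 * Qsq * Real.exp (-4 * c x + s * (m * (α x + δ x - 4 * C x)))
        + κ / 2 * Real.exp (2 * d x + s * (m * (δ x - α x))) * φ₁ x ^ 2 := by
      funext s
      rw [hamiltonian, ta, tc, xa, xxc, xc, tφ, xφ, Ta, Td, Tc]
      simp only [← hm]
      rw [show -d x + s * (m * α x) - (d x + s * (m * δ x))
          = -2 * d x + s * (m * (α x - δ x)) by ring,
        show d x + s * (m * δ x) - (-d x + s * (m * α x))
          = 2 * d x + s * (m * (δ x - α x)) by ring,
        show -d x + s * (m * α x) + (d x + s * (m * δ x)) - 2 * (c x + s * (m * C x))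
          = -2 * c x + s * (m * (α x + δ x - 2 * C x)) by ring,
        show -d x + s * (m * α x) + (d x + s * (m * δ x)) - 4 * (c x + s * (m * C x))
          = -4 * c x + s * (m * (α x + δ x - 4 * C x)) by ring]
      ring
    rw [H]
    refine HasDerivAt.congr_deriv ((((((hasDerivAt_exp_affine _ _).mul
      ((hasDerivAt_affine _ _).add ((hasDerivAt_affine _ _).mul (hasDerivAt_affine _ _)))).sub
      ((hasDerivAt_exp_affine _ _).mul ((hasDerivAt_affine _ _).mul (hasDerivAt_affine _ _)))).sub
      (hasDerivAt_exp_affine _ _)).add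
      ((hasDerivAt_exp_affine _ _).const_mul (κ₀ / 2 * Qsq))).add
      (((hasDerivAt_exp_affine _ _).const_mul (κ / 2)).mul_const (φ₁ x ^ 2))) ?_
    simp only [Pi.mul_apply, Pi.add_apply, zero_mul, add_zero]
    linear_combination m * e₄ x
  · have H : (fun s => momentum κ (T s) t x) = fun s =>
        (0 + s * (2 * (β * m * C₁ x)))
        + (0 + s * (2 * (β * m * C x))) * (c₁ x + s * (m * C₁ x))
        - (0 + s * (2 * (β * m * C x))) * (d₁ x + s * (m * δ₁ x))
        - (0 + s * (2 * (β * m * α x))) * (c₁ x + s * (m * C₁ x)) := by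
      funext s
      rw [momentum, txc, ta, tc, xd, xc, tφ]
      simp only [← hm]
      ring
    rw [H]
    refine HasDerivAt.congr_deriv ((((hasDerivAt_affine _ _).add
      ((hasDerivAt_affine _ _).mul (hasDerivAt_affine _ _))).sub
      ((hasDerivAt_affine _ _).mul (hasDerivAt_affine _ _))).sub
      ((hasDerivAt_affine _ _).mul (hasDerivAt_affine _ _))) ?_
    simp only [zero_mul, add_zero]
    linear_combination (2 * β * m) * e₅ x

end

end ChargedWormhole

end
-- The growing mode generated by the bound state.
noncomputable section

namespace ChargedWormhole

namespace Wormhole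

open Filter Topology Set MeasureTheory SturmSystem

variable {κ₀ κ : ℝ} (w : Wormhole κ₀ κ)

/-- The derivative of `d`. -/
def d₁ (x : ℝ) : ℝ := w.γ₁ * w.b / ((x ^ 2 + w.b ^ 2) * w.P x)

/-- The second derivative of `d`. -/
def d₂ (x : ℝ) : ℝ :=
  w.γ₁ * w.b * (w.γ₁ * w.b - 2 * x * w.P x) / ((x ^ 2 + w.b ^ 2) * w.P x) ^ 2

/-- The derivative of `c`. -/
def c₁ (x : ℝ) : ℝ := x / (x ^ 2 + w.b ^ 2) - w.d₁ x

/-- The second derivative of `c`. -/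
def c₂ (x : ℝ) : ℝ := (w.b ^ 2 - x ^ 2) / (x ^ 2 + w.b ^ 2) ^ 2 - w.d₂ x

/-- The amplitude `A - C = e^c χ` of the mode. -/
def amp (u : ℝ → ℝ) (x : ℝ) : ℝ := Real.exp (w.c x) * u x

/-- `e^c χₓ`, in terms of `v = ∂χ`. -/
def ampD (v : ℝ → ℝ) (x : ℝ) : ℝ := Real.exp (w.c x) * w.weight x * v x

/-- The radial part of `δc` for the mode of growth rate `β`. -/
def modeC (β : ℝ) (u v : ℝ → ℝ) (x : ℝ) : ℝ :=
  Real.exp w.γ₀ ^ 4 / (β ^ 2 * (x ^ 2 + w.b ^ 2) * w.P x ^ 4) *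
    ((x - w.γ₁ * w.b / w.P x) * w.ampD v x -
      w.b * (w.b * w.P x ^ 2 + w.γ₁ * x * w.P x - w.γ₁ ^ 2 * w.b) /
        ((x ^ 2 + w.b ^ 2) * w.P x ^ 2) * w.amp u x)

/-- The mode generated by a bound state, in the gauge `δΦ = 0`. -/
def mode (β : ℝ) (u v : ℝ → ℝ) : Fields :=
  modeFields β (fun x => w.amp u x - w.modeC β u v x) (fun x => w.modeC β u v x + w.amp u x)
    (w.modeC β u v)

variable {w} {β : ℝ} {u v : ℝ → ℝ}

lemma IsCritical.hasDerivAt_d₁ (hw : w.IsCritical) (x : ℝ) : HasDerivAt w.d₁ (w.d₂ x) x := by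
  have hP := hw.P_pos x
  have hr := w.r_pos x
  refine ((hasDerivAt_const x (w.γ₁ * w.b)).div ((w.hasDerivAt_r x).mul (w.hasDerivAt_P x))
    (mul_ne_zero hr.ne' hP.ne')).congr_deriv ?_
  rw [d₂]
  simp only [Pi.mul_apply]
  field_simp
  ring

lemma IsCritical.hasDerivAt_c₁ (hw : w.IsCritical) (x : ℝ) : HasDerivAt w.c₁ (w.c₂ x) x := by
  have hr := w.r_pos x
  refine (((hasDerivAt_id x).div (w.hasDerivAt_r x) hr.ne').sub
    (hw.hasDerivAt_d₁ x)).congr_deriv ?_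
  rw [c₂]
  simp only [id]
  ring

lemma IsCritical.hasDerivAt_amp (hw : w.IsCritical) (h : IsSol w.weight w.W (β ^ 2) u v) (x : ℝ) :
    HasDerivAt (w.amp u) (w.c₁ x * w.amp u x + w.ampD v x) x :=
  ((hw.hasDerivAt_c x).exp.mul (h.du x)).congr_deriv (by rw [c₁, d₁, amp, ampD]; ring)

/-- The coefficient of `e^c χ` in the derivative of `e^c χₓ`. -/
def ampCoeff (w : Wormhole κ₀ κ) (β x : ℝ) : ℝ :=
  w.b ^ 2 / (x ^ 2 + w.b ^ 2) ^ 2 *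
      (-3 + 4 * (w.γ₁ / w.P x) ^ 2 - 2 * (w.γ₁ / w.P x) * (x / w.b)) +
    w.P x ^ 4 * β ^ 2 / Real.exp w.γ₀ ^ 4

lemma IsCritical.hasDerivAt_ampD (hw : w.IsCritical) (h : IsSol w.weight w.W (β ^ 2) u v)
    (x : ℝ) :
    HasDerivAt (w.ampD v)
      ((w.c₁ x - 2 * w.d₁ x) * w.ampD v x + w.ampCoeff β x * w.amp u x) x := by
  have hP := hw.P_pos x
  have hr := w.r_pos x
  have hb := w.b_pos
  have hwt : HasDerivAt w.weight (-2 * w.d₁ x * w.weight x) x :=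
    ((hw.hasDerivAt_d x).const_mul (-2)).exp.congr_deriv (by rw [weight, d₁]; ring)
  refine (((hw.hasDerivAt_c x).exp.mul hwt).mul (h.dv x)).congr_deriv ?_
  -- This is the master equation in the coordinate x: one factor of the weight comes from `ampD`,
  -- the other from v' = p (W + β²) u.
  have e : w.ampCoeff β x = w.weight x ^ 2 * (w.W x + β ^ 2) := by
    rw [ampCoeff, hw.weight_eq, hw.W_eq]
    field_simp
  rw [e, c₁, d₁, amp, ampD]
  simp only [Pi.mul_apply]
  ring

/-- The momentum constraint for the mode. -/
lemma IsCritical.hasDerivAt_modeC (hw : w.IsCritical) (hβ : 0 < β)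
    (h : IsSol w.weight w.W (β ^ 2) u v) (x : ℝ) :
    HasDerivAt (w.modeC β u v) (w.d₁ x * w.modeC β u v x + w.c₁ x * w.amp u x) x := by
  have hP := hw.P_pos x
  have hr := w.r_pos x
  have hb := w.b_pos
  have dP := w.hasDerivAt_P x
  have df := hw.hasDerivAt_amp h x
  have dg := hw.hasDerivAt_ampD h x
  have dr := w.hasDerivAt_r x
  refine ((((hasDerivAt_const x (Real.exp w.γ₀ ^ 4)).div ((dr.const_mul (β ^ 2)).mul (dP.pow 4))
    (mul_ne_zero (mul_ne_zero (pow_ne_zero 2 hβ.ne') hr.ne') (pow_ne_zero 4 hP.ne')))).mul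
    ((((hasDerivAt_id x).sub ((hasDerivAt_const x (w.γ₁ * w.b)).div dP hP.ne')).mul dg).sub
    ((((((dP.pow 2).const_mul w.b).add (((hasDerivAt_id x).const_mul w.γ₁).mul dP)).sub_const
      (w.γ₁ ^ 2 * w.b)).const_mul w.b).div (dr.mul (dP.pow 2))
      (mul_ne_zero hr.ne' (pow_ne_zero 2 hP.ne')) |>.mul df))).congr_deriv ?_
  rw [modeC, ampCoeff, c₁, d₁]
  simp only [id, Pi.mul_apply, Pi.add_apply, Pi.pow_apply, Pi.div_apply, Pi.sub_apply]
  -- The claim is linear in e^c χ and e^c χₓ with coefficients rational in x and P, since P' is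
  -- rational in x. The two amplitudes can be treated as free variables.
  generalize w.amp u x = f
  generalize w.ampD v x = g
  field_simp
  ring

lemma IsCritical.charge_eq (hw : w.IsCritical) :
    κ₀ * w.Qsq = 2 * w.b ^ 2 * w.γ₁ ^ 2 / Real.exp w.γ₀ ^ 2 := by
  have hb := w.b_pos
  have h : lambdaSq κ₀ w.b w.γ₀ w.γ₁ w.Qe w.Qm = 0 := hw
  have e : Real.exp (2 * w.γ₀) = Real.exp w.γ₀ ^ 2 := by rw [two_mul, Real.exp_add, sq]
  rw [lambdaSq, e] at h
  rw [Qsq]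
  field_simp at h ⊢
  linarith

lemma IsCritical.scalar_eq (hw : w.IsCritical) : κ * w.Φ₁ ^ 2 = -2 := by
  have h := w.scalar_amplitude
  rw [show lambdaSq κ₀ w.b w.γ₀ w.γ₁ w.Qe w.Qm = 0 from hw] at h
  linarith

lemma IsCritical.exp_two_d (hw : w.IsCritical) (x : ℝ) :
    Real.exp (2 * w.d x) = Real.exp w.γ₀ ^ 2 / w.P x ^ 2 := by
  rw [two_mul, Real.exp_add, hw.exp_d]
  ring

lemma IsCritical.exp_neg_two_d (hw : w.IsCritical) (x : ℝ) :
    Real.exp (-2 * w.d x) = w.P x ^ 2 / Real.exp w.γ₀ ^ 2 := hw.weight_eq x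

lemma IsCritical.exp_two_c (hw : w.IsCritical) (x : ℝ) :
    Real.exp (2 * w.c x) = (x ^ 2 + w.b ^ 2) * w.P x ^ 2 / Real.exp w.γ₀ ^ 2 := by
  rw [two_mul, Real.exp_add, hw.exp_c, ← sq, div_pow, mul_pow, Real.sq_sqrt (w.r_pos x).le]

lemma IsCritical.exp_neg_two_c (hw : w.IsCritical) (x : ℝ) :
    Real.exp (-2 * w.c x) = Real.exp w.γ₀ ^ 2 / ((x ^ 2 + w.b ^ 2) * w.P x ^ 2) := by
  rw [show -2 * w.c x = -(2 * w.c x) by ring, Real.exp_neg, hw.exp_two_c, inv_div]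

lemma IsCritical.exp_neg_four_c (hw : w.IsCritical) (x : ℝ) :
    Real.exp (-4 * w.c x) = Real.exp w.γ₀ ^ 4 / ((x ^ 2 + w.b ^ 2) * w.P x ^ 2) ^ 2 := by
  rw [show -4 * w.c x = -2 * w.c x + -2 * w.c x by ring, Real.exp_add, hw.exp_neg_two_c,
    ← sq, div_pow, ← pow_mul]

/-- The mode solves the linearized field equations. -/
theorem IsCritical.mode_solves (hw : w.IsCritical) (hβ : 0 < β)
    (h : IsSol w.weight w.W (β ^ 2) u v) :
    SolvesLinearizedEquations κ₀ κ w.Qsq w.background (w.mode β u v) := by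
  have hb := w.b_pos
  have dC := hw.hasDerivAt_modeC hβ h
  have df := hw.hasDerivAt_amp h
  have dg := hw.hasDerivAt_ampD h
  have dd₁ := hw.hasDerivAt_d₁
  have dc₁ := hw.hasDerivAt_c₁
  have dφ₁ : ∀ x, HasDerivAt (fun x => w.Φ₁ * (w.b / (x ^ 2 + w.b ^ 2)))
      (-(w.Φ₁ * w.b * (2 * x)) / (x ^ 2 + w.b ^ 2) ^ 2) x := fun x =>
    (((hasDerivAt_const x w.b).div (w.hasDerivAt_r x) (w.r_pos x).ne').const_mul
      w.Φ₁).congr_deriv (by ring)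
  have hK := hw.charge_eq
  have hκ := hw.scalar_eq
  refine solvesLinearizedEquations_of_radial (hd := hw.hasDerivAt_d) (hd₁ := dd₁)
    (hc := hw.hasDerivAt_c) (hc₁ := dc₁) (hφ := fun x => (w.hasDerivAt_y x).const_mul w.Φ₁)
    (hφ₁ := dφ₁) (hδ := fun x => (df x).sub (dC x))
    (hδ₁ := fun x => ((((dc₁ x).mul (df x)).add (dg x)).sub
      (((dd₁ x).mul (dC x)).add ((dc₁ x).mul (df x)))))
    (hα := fun x => (dC x).add (df x)) (hC := dC)
    (hC₁ := fun x => ((dd₁ x).mul (dC x)).add ((dc₁ x).mul (df x))) ?_ ?_ ?_ ?_ ?_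
  · intro x
    have hP := hw.P_pos x
    have hr := w.r_pos x
    -- The scalar background enters only through κ Φ₁² = -2, and δd - δa = -2 δc.
    have hφ : κ / 2 * Real.exp (2 * w.d x) * (w.amp u x - w.modeC β u v x
        - (w.modeC β u v x + w.amp u x)) * (w.Φ₁ * (w.b / (x ^ 2 + w.b ^ 2))) ^ 2
        = (2 * Real.exp (2 * w.d x) * w.modeC β u v x) * (w.b / (x ^ 2 + w.b ^ 2)) ^ 2 := by
      linear_combination (-Real.exp (2 * w.d x) * w.modeC β u v x *
        (w.b / (x ^ 2 + w.b ^ 2)) ^ 2) * hκ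
    rw [hφ, hK, hw.exp_neg_two_d, hw.exp_two_d, hw.exp_neg_two_c, hw.exp_neg_four_c]
    simp only [modeC, ampCoeff, c₂, c₁, d₂, d₁]
    generalize w.amp u x = f
    generalize w.ampD v x = g
    field_simp
    ring
  -- This equation is the source of the formula for `modeC`. After the momentum constraint removes
  -- the derivatives of δc, all terms in δc except the one with β² cancel by the charge relation,
  -- and δc can be solved for.
  · intro x
    have hP := hw.P_pos x
    have hr := w.r_pos x
    have hK2 : κ₀ / 2 * w.Qsq = w.b ^ 2 * w.γ₁ ^ 2 / Real.exp w.γ₀ ^ 2 := by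
      linear_combination hK / 2
    rw [Real.exp_add, Real.exp_add, hK2, hw.exp_neg_two_d, hw.exp_two_d, hw.exp_neg_two_c,
      hw.exp_two_c]
    simp only [modeC, c₂, c₁, d₂, d₁]
    generalize w.amp u x = f
    generalize w.ampD v x = g
    field_simp
    ring
  -- Here δd - δa + 2 δc vanishes identically, and so does its derivative.
  · intro x
    ring
  · intro x
    have hP := hw.P_pos x
    have hr := w.r_pos x
    have hφ : κ / 2 * Real.exp (2 * w.d x) * (w.amp u x - w.modeC β u v x
        - (w.modeC β u v x + w.amp u x)) * (w.Φ₁ * (w.b / (x ^ 2 + w.b ^ 2))) ^ 2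
        = (2 * Real.exp (2 * w.d x) * w.modeC β u v x) * (w.b / (x ^ 2 + w.b ^ 2)) ^ 2 := by
      linear_combination (-Real.exp (2 * w.d x) * w.modeC β u v x *
        (w.b / (x ^ 2 + w.b ^ 2)) ^ 2) * hκ
    have hK2 : κ₀ / 2 * w.Qsq = w.b ^ 2 * w.γ₁ ^ 2 / Real.exp w.γ₀ ^ 2 := by
      linear_combination hK / 2
    rw [hφ, hK2, hw.exp_two_d, hw.exp_neg_two_c, hw.exp_neg_four_c]
    simp only [c₂, c₁, d₂, d₁]
    -- The explicit formula for δc is not needed: given the momentum constraint, the Hamiltonian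
    -- constraint holds identically in δc, e^c χ and e^c χₓ.
    generalize w.modeC β u v x = C
    generalize w.amp u x = f
    generalize w.ampD v x = g
    field_simp
    ring
  · intro x
    change w.d₁ x * w.modeC β u v x + w.c₁ x * w.amp u x + w.c₁ x * w.modeC β u v x
      - w.d₁ x * w.modeC β u v x - w.c₁ x * (w.modeC β u v x + w.amp u x) = 0
    ring

lemma IsCritical.contDiff_amp (hw : w.IsCritical) (h : IsSol w.weight w.W (β ^ 2) u v) :
    ContDiff ℝ ((⊤ : ℕ∞) : WithTop ℕ∞) (w.amp u) :=
  (Real.contDiff_exp.comp hw.contDiff_c).mul (hw.contDiff_of_isSol h).1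

lemma IsCritical.contDiff_modeC (hw : w.IsCritical) (hβ : 0 < β)
    (h : IsSol w.weight w.W (β ^ 2) u v) :
    ContDiff ℝ ((⊤ : ℕ∞) : WithTop ℕ∞) (w.modeC β u v) := by
  have hf := hw.contDiff_amp h
  have hg : ContDiff ℝ ((⊤ : ℕ∞) : WithTop ℕ∞) (w.ampD v) :=
    ((Real.contDiff_exp.comp hw.contDiff_c).mul hw.contDiff_weight).mul (hw.contDiff_of_isSol h).2
  have hP : ContDiff ℝ ((⊤ : ℕ∞) : WithTop ℕ∞) w.P := w.contDiff_P
  have hP0 : ∀ x, w.P x ≠ 0 := fun x => (hw.P_pos x).ne'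
  have hr0 : ∀ x, x ^ 2 + w.b ^ 2 ≠ 0 := fun x => (w.r_pos x).ne'
  have hr : ContDiff ℝ ((⊤ : ℕ∞) : WithTop ℕ∞) fun x : ℝ => x ^ 2 + w.b ^ 2 := by fun_prop
  exact (contDiff_const.div ((contDiff_const.mul hr).mul (hP.pow 4)) fun x =>
      mul_ne_zero (mul_ne_zero (pow_ne_zero 2 hβ.ne') (hr0 x)) (pow_ne_zero 4 (hP0 x))).mul
    (((contDiff_id.sub (contDiff_const.div hP hP0)).mul hg).sub
      (((contDiff_const.mul (((contDiff_const.mul (hP.pow 2)).add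
        ((contDiff_const.mul contDiff_id).mul hP)).sub contDiff_const)).div (hr.mul (hP.pow 2))
        fun x => mul_ne_zero (hr0 x) (pow_ne_zero 2 (hP0 x))).mul hf))

/-- In the gauge δΦ = 0 the invariants A and C are δa and δc themselves, and δa - δc = e^{βt} e^c u.
-/
lemma u₁_mode (t x : ℝ) : w.u₁ (w.mode β u v) t x = Real.exp (β * t) * u x := by
  have h : Real.exp (-w.c x) * Real.exp (w.c x) = 1 := by rw [← Real.exp_add]; simp
  simp only [u₁, gaugeA, gaugeC, mode, modeFields, px, zero_div, mul_zero, deriv_const, sub_zero,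
    amp]
  linear_combination Real.exp (β * t) * u x * h

lemma u₂_mode (t x : ℝ) :
    w.u₂ (w.mode β u v) t x = Real.exp (β * t) * (Real.exp (-w.c x) * w.modeC β u v x) := by
  simp only [u₂, gaugeC, mode, modeFields, zero_div, mul_zero, sub_zero]
  ring

lemma IsCritical.masterField_mode (hw : w.IsCritical) (t x : ℝ) :
    w.masterField (w.mode β u v) t x = Real.exp (β * t) * u x := by
  rw [masterField, hw.G_eq, u₁_mode]
  ring

lemma SquareIntegrable.const_mul {f : ℝ → ℝ} (hf : w.SquareIntegrable f) (k : ℝ) :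
    w.SquareIntegrable fun x => k * f x := by
  have := Integrable.const_mul hf (k ^ 2)
  refine this.congr (Eventually.of_forall fun x => ?_)
  simp only
  ring

lemma SquareIntegrable.of_abs_le {f : ℝ → ℝ} (hw : w.IsCritical) (hu : w.SquareIntegrable u)
    (hv : w.SquareIntegrable v) (hf : Continuous f) (K : ℝ)
    (h : ∀ x, |f x| ≤ K * (|u x| + |v x|)) : w.SquareIntegrable f := by
  rw [squareIntegrable_iff] at *
  have hc : Continuous w.weight := (hw.contDiff_weight (n := 0)).continuous
  refine Integrable.mono' ((hu.add hv).const_mul (2 * K ^ 2))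
    (Continuous.aestronglyMeasurable (by fun_prop)) (Eventually.of_forall fun x => ?_)
  have hp := w.weight_pos x
  have h1 : f x ^ 2 ≤ (K * (|u x| + |v x|)) ^ 2 := by
    rw [← sq_abs (f x)]
    exact pow_le_pow_left₀ (abs_nonneg _) (h x) 2
  have h2 : (|u x| + |v x|) ^ 2 ≤ 2 * (u x ^ 2 + v x ^ 2) := by
    rw [← sq_abs (u x), ← sq_abs (v x)]
    nlinarith [sq_nonneg (|u x| - |v x|)]
  rw [Real.norm_of_nonneg (by positivity)]
  simp only [Pi.add_apply]
  calc w.weight x * f x ^ 2 ≤ w.weight x * (K ^ 2 * (2 * (u x ^ 2 + v x ^ 2))) := by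
        gcongr
        refine h1.trans ?_
        rw [mul_pow]
        exact mul_le_mul_of_nonneg_left h2 (sq_nonneg K)
    _ = _ := by ring

lemma abs_mul_b_le (x : ℝ) : |x| ≤ (x ^ 2 + w.b ^ 2) / w.b := by
  have hb := w.b_pos
  rw [le_div_iff₀ hb, ← sq_abs x]
  nlinarith [sq_nonneg (|x| - w.b), abs_nonneg x, mul_nonneg (abs_nonneg x) hb.le]

/-- The factors e^{c} and e^{-c} cancel, leaving coefficients of v and u that are rational in x and
P. They are bounded because m ≤ P ≤ 2 and x² + b² dominates both b |x| and b². Square integrability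
of u₂ thus follows from that of u and v = ∂u. -/
lemma IsCritical.exists_modeC_le (hw : w.IsCritical) (hβ : 0 < β) :
    ∃ K, ∀ x, |Real.exp (-w.c x) * w.modeC β u v x| ≤ K * (|u x| + |v x|) := by
  obtain ⟨m, hm, hP⟩ := hw.exists_bounds
  have hb := w.b_pos
  set k := Real.exp w.γ₀ with hk
  have hk0 : 0 < k := Real.exp_pos _
  set K₁ := k ^ 4 / (β ^ 2 * m ^ 4) with hK₁
  set K₂ := (1 / w.b + |w.γ₁| / (m * w.b)) * (2 ^ 2 / k ^ 2) with hK₂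
  set K₃ := (w.b ^ 2 * 2 ^ 2 + |w.γ₁| * w.b * 2 * w.b + w.γ₁ ^ 2 * w.b ^ 2) / (w.b ^ 4 * m ^ 2) with hK₃
  refine ⟨K₁ * (K₂ + K₃), fun x => ?_⟩
  have hr := w.r_pos x
  have hPx := hw.P_pos x
  have hP1 := (hP x).1
  have hP2 := (hP x).2
  have hx := abs_mul_b_le (w := w) x
  have hrb : w.b ^ 2 ≤ x ^ 2 + w.b ^ 2 := by nlinarith [sq_nonneg x]
  have hee : Real.exp (-w.c x) * Real.exp (w.c x) = 1 := by rw [← Real.exp_add]; simp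
  set r := x ^ 2 + w.b ^ 2 with hrdef
  have hsplit : Real.exp (-w.c x) * w.modeC β u v x = k ^ 4 / (β ^ 2 * w.P x ^ 4) *
      (((x - w.γ₁ * w.b / w.P x) / r * (w.P x ^ 2 / k ^ 2)) * v x -
      w.b * (w.b * w.P x ^ 2 + w.γ₁ * x * w.P x - w.γ₁ ^ 2 * w.b) / (r ^ 2 * w.P x ^ 2) * u x) := by
    rw [modeC, ampD, amp, hw.weight_eq, ← hrdef, ← hk]
    have e : ∀ A B C D : ℝ, Real.exp (-w.c x) * (A * (B * (Real.exp (w.c x) * C * v x)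
        - D * (Real.exp (w.c x) * u x))) = A * (B * (C * v x) - D * u x) := fun A B C D => by
      linear_combination (A * (B * (C * v x) - D * u x)) * hee
    rw [e]
    field_simp
  have b1 : |k ^ 4 / (β ^ 2 * w.P x ^ 4)| ≤ K₁ := by
    rw [abs_of_pos (by positivity), hK₁]
    gcongr
  have b2 : |(x - w.γ₁ * w.b / w.P x) / r * (w.P x ^ 2 / k ^ 2)| ≤ K₂ := by
    rw [abs_mul, abs_of_pos (by positivity : 0 < w.P x ^ 2 / k ^ 2), abs_div, abs_of_pos hr]
    refine mul_le_mul ?_ (by gcongr) (by positivity) (by positivity)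
    rw [div_le_iff₀ hr]
    refine (abs_sub _ _).trans ?_
    rw [abs_div, abs_mul, abs_of_pos hb, abs_of_pos hPx, add_mul]
    refine add_le_add (hx.trans (by rw [div_mul_eq_mul_div, one_mul])) ?_
    calc |w.γ₁| * w.b / w.P x ≤ |w.γ₁| * w.b / m := by gcongr
      _ = |w.γ₁| / (m * w.b) * w.b ^ 2 := by field_simp
      _ ≤ _ := by gcongr
  have b3 : |w.b * (w.b * w.P x ^ 2 + w.γ₁ * x * w.P x - w.γ₁ ^ 2 * w.b) / (r ^ 2 * w.P x ^ 2)|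
      ≤ K₃ := by
    rw [abs_div, abs_of_pos (by positivity : 0 < r ^ 2 * w.P x ^ 2), hK₃,
      div_le_div_iff₀ (by positivity) (by positivity)]
    have h1 : |w.b * (w.b * w.P x ^ 2 + w.γ₁ * x * w.P x - w.γ₁ ^ 2 * w.b)|
        ≤ w.b ^ 2 * 2 ^ 2 + |w.γ₁| * w.b * 2 * |x| + w.γ₁ ^ 2 * w.b ^ 2 := by
      have e : w.b * (w.b * w.P x ^ 2 + w.γ₁ * x * w.P x - w.γ₁ ^ 2 * w.b)
        = w.b ^ 2 * w.P x ^ 2 + w.γ₁ * w.b * w.P x * x - w.γ₁ ^ 2 * w.b ^ 2 := by ring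
      rw [e]
      refine (abs_sub _ _).trans (add_le_add ((abs_add_le _ _).trans (add_le_add ?_ ?_)) ?_)
      · rw [abs_of_pos (by positivity)]
        gcongr
      · rw [abs_mul, abs_mul, abs_mul, abs_of_pos hb, abs_of_pos hPx]
        gcongr
      · rw [abs_of_nonneg (by positivity)]
    have h2 : |w.b * (w.b * w.P x ^ 2 + w.γ₁ * x * w.P x - w.γ₁ ^ 2 * w.b)| * w.b ^ 2
        ≤ (w.b ^ 2 * 2 ^ 2 + |w.γ₁| * w.b * 2 * w.b + w.γ₁ ^ 2 * w.b ^ 2) * r := by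
      have hx' : |x| * w.b ^ 2 ≤ w.b * r := by
        have := mul_le_mul_of_nonneg_right hx (sq_nonneg w.b)
        calc _ ≤ _ := this
          _ = _ := by field_simp
      have a1 := mul_le_mul_of_nonneg_right h1 (sq_nonneg w.b)
      have a2 : 0 ≤ |w.γ₁| * w.b * 2 := by positivity
      have a3 : 0 ≤ w.b ^ 2 * 2 ^ 2 + w.γ₁ ^ 2 * w.b ^ 2 := by positivity
      nlinarith [mul_le_mul_of_nonneg_left hx' a2, mul_le_mul_of_nonneg_left hrb a3]
    calc _ = (|w.b * (w.b * w.P x ^ 2 + w.γ₁ * x * w.P x - w.γ₁ ^ 2 * w.b)| * w.b ^ 2)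
          * (w.b ^ 2 * m ^ 2) := by ring
      _ ≤ ((w.b ^ 2 * 2 ^ 2 + |w.γ₁| * w.b * 2 * w.b + w.γ₁ ^ 2 * w.b ^ 2) * r)
          * (r * w.P x ^ 2) := by gcongr
      _ = _ := by ring
  have p1 : 0 ≤ K₁ := by positivity
  have p2 : 0 ≤ K₂ := by positivity
  have p3 : 0 ≤ K₃ := by positivity
  rw [hsplit, abs_mul]
  calc _ ≤ K₁ * (K₂ * |v x| + K₃ * |u x|) := by
        refine mul_le_mul b1 ((abs_sub _ _).trans (add_le_add ?_ ?_)) (abs_nonneg _) p1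
        · rw [abs_mul]
          gcongr
        · rw [abs_mul]
          gcongr
    _ ≤ K₁ * ((K₂ + K₃) * (|u x| + |v x|)) := by
        gcongr
        nlinarith [mul_nonneg p2 (abs_nonneg (u x)), mul_nonneg p3 (abs_nonneg (v x))]
    _ = _ := by ring

theorem IsCritical.isMode_mode (hw : w.IsCritical) (hβ : 0 < β)
    (h : IsSol w.weight w.W (β ^ 2) u v) (hu : w.SquareIntegrable u) (hv : w.SquareIntegrable v)
    (hne : ∃ x, u x ≠ 0) : w.IsMode β (w.mode β u v) := by
  have hf := hw.contDiff_amp h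
  have hC := hw.contDiff_modeC hβ h
  refine ⟨⟨_, hf.sub hC, fun t x => rfl⟩, ⟨_, hC.add hf, fun t x => rfl⟩, ⟨_, hC, fun t x => rfl⟩,
    ⟨fun _ => 0, contDiff_const, fun t x => (mul_zero _).symm⟩, hw.mode_solves hβ h,
    fun t => ⟨?_, ?_⟩, ?_⟩
  · have : w.u₁ (w.mode β u v) t = fun x => Real.exp (β * t) * u x := funext fun x => u₁_mode t x
    rw [this]
    exact hu.const_mul _
  · have : w.u₂ (w.mode β u v) t = fun x => Real.exp (β * t) *
        (Real.exp (-w.c x) * w.modeC β u v x) := funext fun x => u₂_mode t x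
    rw [this]
    obtain ⟨K, hK⟩ := hw.exists_modeC_le (u := u) (v := v) hβ
    refine SquareIntegrable.const_mul (SquareIntegrable.of_abs_le hw hu hv ?_ K hK) _
    exact (Real.continuous_exp.comp (hw.contDiff_c (n := 0)).continuous.neg).mul hC.continuous
  · obtain ⟨x, hx⟩ := hne
    exact ⟨0, x, Or.inl (by rw [u₁_mode]; simpa using hx)⟩

end Wormhole

end ChargedWormhole

end

theorem mainTheorem2 (κ₀ κ : ℝ) (hκ₀ : 0 < κ₀) (hκ : κ < 0)
    (w : ChargedWormhole.Wormhole κ₀ κ) (hw : w.IsCritical) :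
    (w.IsStationary 0 w.zeroMode ∧ ¬ w.SquareIntegrable w.zeroMode) ∧
    ∃ β : ℝ, 0 < β ∧ ∃ χβ : ℝ → ℝ,
      w.IsBoundState (-β ^ 2) χβ ∧
      (∀ (E : ℝ) (χ : ℝ → ℝ), E < 0 → w.IsBoundState E χ →
        E = -β ^ 2 ∧ ∃ k : ℝ, ∀ x, χ x = k * χβ x) ∧
      ∃ δ : ChargedWormhole.Fields, w.IsMode β δ ∧
        ∀ t x, w.masterField δ t x = Real.exp (β * t) * χβ x := by
  refine ⟨⟨hw.zeroMode_isStationary, hw.zeroMode_not_squareIntegrable⟩, ?_⟩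
  obtain ⟨β, hβ, u, v, h, hu, hv, huniq⟩ := hw.exists_unique_bound_state
  exact ⟨β, hβ, u, hu, huniq, w.mode β u v, hw.isMode_mode hβ h hu.2.1 hv hu.2.2,
    hw.masterField_mode⟩
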